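/- Let $(\mathcal M,\mathbf g)$ be a smooth four-dimensional pseudo-Riemannian manifold of arbitrary signature with two commuting smooth Killing vector fields $\xi_{1},\xi_{2}$ such that $\mathbf g$ restricted to $\Xi=\operatorname{span}(\xi_1,\xi_2)$ is nondegenerate at every point (a $\mathrm G_2$-metric; $\mathbf g$ is allowed to have further Killing fields), and let $\Xi^\perp$ be the orthogonal distribution. Suppose that $\mathbf g$ satisfies the $\Lambda$-vacuum Einstein equations $R_{\mu\nu}-\Lambda\,\mathbf g_{\mu\nu}=0$ for some $\Lambda\in\mathbb R$. Then at every point the sectional curvatures of $\Xi$ and $\Xi^\perp$ coincide: $$K(\Xi)=K(\Xi^\perp).$$ Here $K$ of the plane spanned by $u,v$ is $\dfrac{\mathbf g(R(u,v)v,u)}{\mathbf g(u,u)\mathbf g(v,v)-\mathbf g(u,v)^2}$ with $R(X,Y)=[\nabla_X,\nabla_Y]-\nabla_{[X,Y]}$, $\nabla$ being the Levi-Civita connection. Moreover, in all local coordinates $t^1,t^2,z^1,z^2$ with $\xi_k=\partial/\partial z^k$ (adapted coordinates), write $$\mathbf g=\tilde g_{ij}\,dt^i dt^j+h_{kl}\,(dz^k+f^k_i\,dt^i)(dz^l+f^l_j\,dt^j),$$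 where all coefficients depend locally on $t^1,t^2$ only, and put $\mathbf e_i=\partial_{t^i}-f_i^k\partial_{z^k}$. Then $$K(\Xi)=K(\partial_{z^1},\partial_{z^2})=-\tfrac14 C_\chi,\qquad K(\Xi^\perp)=K(\mathbf e_1,\mathbf e_2)=\tfrac12 C_{\mathrm{ric}}-\tfrac34\,\varepsilon\,\ell_{\mathcal C},\qquad C_{\mathrm{ric}}+\tfrac12 C_\chi-\tfrac32\,\varepsilon\,\ell_{\mathcal C}=0,$$ where $\varepsilon=\operatorname{sgn}\det(\tilde g_{ij})$; $C_{\mathrm{ric}}$ is the scalar curvature of the two-dimensional metric $\tilde g_{ij}\,dt^i dt^j$; $C_\chi=\tilde g^{ij}\chi_{ij}$ with $\chi=(\det h)^{-1}(dh_{11}\,dh_{22}-dh_{12}\,dh_{12})$, a symmetric tensor; and $\ell_{\mathcal C}=h_{kl}\,\mathcal C^k\mathcal C^l$ with $\mathcal C^k=(\partial_{t^2}f^k_1-\partial_{t^1}f^k_2)/\sqrt{|\det(\tilde g_{ij})|}$. -/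

import Mathlib

open scoped Manifold ContDiff

noncomputable section

/-! ### Classical tensor calculus in coordinates

A metric on (an open subset of) `ℝⁿ` is given by its matrix of components, a function
`G : EuclideanSpace ℝ (Fin n) → Matrix (Fin n) (Fin n) ℝ`. -/

/-- The partial derivative `∂ᵢ F` at `x`. -/
def partialDeriv {n : ℕ} (i : Fin n) (F : EuclideanSpace ℝ (Fin n) → ℝ)
    (x : EuclideanSpace ℝ (Fin n)) : ℝ :=
  fderiv ℝ F x (EuclideanSpace.single i 1)

/-- The Christoffel symbol `Γᵏᵢⱼ = ½ gᵏˡ (∂ᵢ gₗⱼ + ∂ⱼ gₗᵢ - ∂ₗ gᵢⱼ)` of the Levi-Civita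
connection of `G`. -/
def christoffel {n : ℕ} (G : EuclideanSpace ℝ (Fin n) → Matrix (Fin n) (Fin n) ℝ)
    (k i j : Fin n) (x : EuclideanSpace ℝ (Fin n)) : ℝ :=
  (1 / 2) * ∑ l, (G x)⁻¹ k l *
    (partialDeriv i (fun y => G y l j) x + partialDeriv j (fun y => G y l i) x
      - partialDeriv l (fun y => G y i j) x)

/-- The component `Rˡₖᵢⱼ` of the Riemann tensor
`R(X, Y) Z = ∇_X ∇_Y Z - ∇_Y ∇_X Z - ∇_[X,Y] Z`, that is, `R(∂ᵢ, ∂ⱼ) ∂ₖ = Rˡₖᵢⱼ ∂ₗ`. -/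
def riemann {n : ℕ} (G : EuclideanSpace ℝ (Fin n) → Matrix (Fin n) (Fin n) ℝ)
    (l k i j : Fin n) (x : EuclideanSpace ℝ (Fin n)) : ℝ :=
  partialDeriv i (christoffel G l j k) x - partialDeriv j (christoffel G l i k) x
    + ∑ m, (christoffel G l i m x * christoffel G m j k x
      - christoffel G l j m x * christoffel G m i k x)

/-- The Ricci tensor `Ric(∂ⱼ, ∂ₖ) = tr (X ↦ R(X, ∂ⱼ) ∂ₖ) = Rⁱₖᵢⱼ`. -/
def ricci {n : ℕ} (G : EuclideanSpace ℝ (Fin n) → Matrix (Fin n) (Fin n) ℝ)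
    (j k : Fin n) (x : EuclideanSpace ℝ (Fin n)) : ℝ :=
  ∑ i, riemann G i k i j x

/-- The scalar curvature `gʲᵏ Ricⱼₖ`. -/
def scalarCurvature {n : ℕ} (G : EuclideanSpace ℝ (Fin n) → Matrix (Fin n) (Fin n) ℝ)
    (x : EuclideanSpace ℝ (Fin n)) : ℝ :=
  ∑ j, ∑ k, (G x)⁻¹ j k * ricci G j k x

/-- The scalar product `g(u, v)` at `x` of two vectors given by their components. -/
def coordInner {n : ℕ} (G : EuclideanSpace ℝ (Fin n) → Matrix (Fin n) (Fin n) ℝ)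
    (x u v : EuclideanSpace ℝ (Fin n)) : ℝ :=
  ∑ i, ∑ j, G x i j * u i * v j

/-- The components of the vector `R(u, v) w` at `x`. -/
def curvatureOp {n : ℕ} (G : EuclideanSpace ℝ (Fin n) → Matrix (Fin n) (Fin n) ℝ)
    (x u v w : EuclideanSpace ℝ (Fin n)) : EuclideanSpace ℝ (Fin n) :=
  WithLp.toLp 2 fun l => ∑ k, ∑ i, ∑ j, riemann G l k i j x * u i * v j * w k

/-- The sectional curvature `g(R(u, v) v, u) / (g(u, u) g(v, v) - g(u, v)²)` at `x` of the plane
spanned by `u` and `v` (positive for round spheres). -/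
def coordSectional {n : ℕ} (G : EuclideanSpace ℝ (Fin n) → Matrix (Fin n) (Fin n) ℝ)
    (x u v : EuclideanSpace ℝ (Fin n)) : ℝ :=
  coordInner G x (curvatureOp G x u v v) u /
    (coordInner G x u u * coordInner G x v v - coordInner G x u v ^ 2)

/-! ### Four-dimensional pseudo-Riemannian manifolds -/

/-- The model space of four-dimensional manifolds. In adapted coordinates the indices `0, 1`
(that is, `Fin.castAdd 2 i`) belong to `t¹, t²` and the indices `2, 3` (that is, `Fin.natAdd 2 k`)
to `z¹, z²`. -/
abbrev E4 : Type := EuclideanSpace ℝ (Fin (2 + 2))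

/-- Coordinates `t¹, t²` or `z¹, z²`. -/
abbrev E2 : Type := EuclideanSpace ℝ (Fin 2)

section Manifolds

variable {M : Type*} [TopologicalSpace M] [ChartedSpace E4 M]

/-- The tangent vector `∂/∂xᵃ` at `p` of the coordinate system `φ`. -/
def coordVector (φ : OpenPartialHomeomorph M E4) (p : M) (a : Fin (2 + 2)) :
    TangentSpace 𝓘(ℝ, E4) p :=
  (mfderiv 𝓘(ℝ, E4) 𝓘(ℝ, E4) φ p).inverse (EuclideanSpace.single a (1 : ℝ) : E4)

/-- The components in the coordinate system `φ` of a tangent vector at `p`. -/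
def coordComponents (φ : OpenPartialHomeomorph M E4) (p : M) (v : TangentSpace 𝓘(ℝ, E4) p) : E4 :=
  mfderiv 𝓘(ℝ, E4) 𝓘(ℝ, E4) φ p v

variable (M) in
/-- A smooth pseudo-Riemannian metric, of any signature, on a four-dimensional manifold. Smoothness
means that the components in every coordinate system are smooth. -/
structure PseudoRiemannianMetric where
  /-- The scalar product on each tangent space. -/
  val : ∀ p : M, LinearMap.BilinForm ℝ (TangentSpace 𝓘(ℝ, E4) p)
  symm : ∀ p u v, val p u v = val p v u
  nondegenerate : ∀ p u, (∀ v, val p u v = 0) → u = 0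
  smooth : ∀ φ ∈ IsManifold.maximalAtlas 𝓘(ℝ, E4) ∞ M, ∀ a b : Fin (2 + 2),
    ContDiffOn ℝ ∞ (fun x : E4 => val (φ.symm x) (coordVector φ (φ.symm x) a)
      (coordVector φ (φ.symm x) b)) φ.target

namespace PseudoRiemannianMetric

/-- The components `g_ab` of the metric in the coordinate system `φ`, as functions of the
coordinates; only their values on `φ.target` are meaningful. -/
def components (g : PseudoRiemannianMetric M) (φ : OpenPartialHomeomorph M E4) (x : E4) :
    Matrix (Fin (2 + 2)) (Fin (2 + 2)) ℝ :=
  Matrix.of fun a b => g.val (φ.symm x) (coordVector φ (φ.symm x) a) (coordVector φ (φ.symm x) b)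

/-- The sectional curvature of the plane spanned by `u, v ∈ T_p M`, computed in the coordinate
system `φ` around `p`. -/
def sectional (g : PseudoRiemannianMetric M) (φ : OpenPartialHomeomorph M E4) (p : M)
    (u v : TangentSpace 𝓘(ℝ, E4) p) : ℝ :=
  coordSectional (g.components φ) (φ p) (coordComponents φ p u) (coordComponents φ p v)

/-- The `Λ`-vacuum Einstein equations `R_μν - Λ g_μν = 0`. -/
def IsLambdaVacuum (g : PseudoRiemannianMetric M) (Λ : ℝ) : Prop :=
  ∀ φ ∈ IsManifold.maximalAtlas 𝓘(ℝ, E4) ∞ M, ∀ x ∈ φ.target, ∀ a b : Fin (2 + 2),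
    ricci (g.components φ) a b x - Λ * g.components φ x a b = 0

/-- `X` is a Killing vector field: in all coordinates,
`(L_X g)_ab = Xᶜ ∂_c g_ab + ∂_a Xᶜ g_cb + ∂_b Xᶜ g_ac = 0`. -/
def IsKilling (g : PseudoRiemannianMetric M) (X : ∀ p : M, TangentSpace 𝓘(ℝ, E4) p) : Prop :=
  ∀ φ ∈ IsManifold.maximalAtlas 𝓘(ℝ, E4) ∞ M, ∀ x ∈ φ.target, ∀ a b : Fin (2 + 2),
    ∑ c, (coordComponents φ (φ.symm x) (X (φ.symm x)) c
          * partialDeriv c (fun y => g.components φ y a b) x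
        + partialDeriv a (fun y => coordComponents φ (φ.symm y) (X (φ.symm y)) c) x
          * g.components φ x c b
        + partialDeriv b (fun y => coordComponents φ (φ.symm y) (X (φ.symm y)) c) x
          * g.components φ x a c) = 0

end PseudoRiemannianMetric

/-- `g` is a `G₂`-metric with respect to `ξ₁, ξ₂`: these are commuting smooth Killing vector fields,
and the restriction of `g` to their span is nondegenerate at each point (so that, in particular,
they are linearly independent at each point). -/
structure IsG2Metric [IsManifold 𝓘(ℝ, E4) ∞ M] (g : PseudoRiemannianMetric M)
    (ξ : Fin 2 → ∀ p : M, TangentSpace 𝓘(ℝ, E4) p) : Prop where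
  smooth : ∀ k, ContMDiff 𝓘(ℝ, E4) 𝓘(ℝ, E4).tangent ∞
    (fun p => (⟨p, ξ k p⟩ : TangentBundle 𝓘(ℝ, E4) M))
  killing : ∀ k, g.IsKilling (ξ k)
  commute : ∀ p, VectorField.mlieBracket 𝓘(ℝ, E4) (ξ 0) (ξ 1) p = 0
  nonnull : ∀ p, (Matrix.of fun k l => g.val p (ξ k p) (ξ l p)).det ≠ 0

/-- The Killing distribution `Ξ`, spanned by `ξ₁` and `ξ₂`. -/
def killingDistribution (ξ : Fin 2 → ∀ p : M, TangentSpace 𝓘(ℝ, E4) p) (p : M) :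
    Submodule ℝ (TangentSpace 𝓘(ℝ, E4) p) :=
  Submodule.span ℝ (Set.range fun k => ξ k p)

/-- The orthogonal distribution `Ξ^⊥`. -/
def orthogonalDistribution (g : PseudoRiemannianMetric M)
    (ξ : Fin 2 → ∀ p : M, TangentSpace 𝓘(ℝ, E4) p) (p : M) :
    Submodule ℝ (TangentSpace 𝓘(ℝ, E4) p) :=
  (g.val p).orthogonal (killingDistribution ξ p)

/-- `φ = (t¹, t², z¹, z²)` is a system of adapted coordinates: `ξ_k = ∂/∂zᵏ`. -/
def IsAdapted [IsManifold 𝓘(ℝ, E4) ∞ M] (ξ : Fin 2 → ∀ p : M, TangentSpace 𝓘(ℝ, E4) p)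
    (φ : OpenPartialHomeomorph M E4) : Prop :=
  φ ∈ IsManifold.maximalAtlas 𝓘(ℝ, E4) ∞ M ∧
    ∀ p ∈ φ.source, ∀ k : Fin 2, ξ k p = coordVector φ p (Fin.natAdd 2 k)

end Manifolds

/-! ### Invariants in adapted coordinates

Below `G` is the matrix of components of the metric in adapted coordinates,
`g = b_ij dtⁱ dtʲ + 2 f_ik dtⁱ dzᵏ + h_kl dzᵏ dzˡ`. -/

namespace Adapted

variable (G : E4 → Matrix (Fin (2 + 2)) (Fin (2 + 2)) ℝ)

/-- The matrix `(b_ij)`. -/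
def b (x : E4) : Matrix (Fin 2) (Fin 2) ℝ := (G x).submatrix (Fin.castAdd 2) (Fin.castAdd 2)

/-- The matrix `(f_ik)`. -/
def f (x : E4) : Matrix (Fin 2) (Fin 2) ℝ := (G x).submatrix (Fin.castAdd 2) (Fin.natAdd 2)

/-- The matrix `(h_kl)`. -/
def h (x : E4) : Matrix (Fin 2) (Fin 2) ℝ := (G x).submatrix (Fin.natAdd 2) (Fin.natAdd 2)

/-- The functions `f_i^k = f_is h^sk`, with row index `i` and column index `k`. -/
def fUp (x : E4) : Matrix (Fin 2) (Fin 2) ℝ := f G x * (h G x)⁻¹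

/-- The components `g̃_ij = b_ij - f_ik f_jl h^kl` of the orbit metric. -/
def orbit (x : E4) : Matrix (Fin 2) (Fin 2) ℝ := b G x - f G x * (h G x)⁻¹ * (f G x).transpose

/-- The point with coordinates `(t, z)`. -/
def join (t z : E2) : E4 := WithLp.toLp 2 (Fin.append t z)

/-- The coordinates `(t¹, t²)` of a point. -/
def tPart (x : E4) : E2 := WithLp.toLp 2 fun i => x (Fin.castAdd 2 i)

/-- The coordinates `(z¹, z²)` of a point. -/
def zPart (x : E4) : E2 := WithLp.toLp 2 fun k => x (Fin.natAdd 2 k)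

/-- `C_ric`, the scalar curvature of the orbit metric `g̃_ij dtⁱ dtʲ`. As the coefficients do not
depend on `z`, they are regarded as functions of `t` by fixing `z`. -/
def Cric (x : E4) : ℝ := scalarCurvature (fun t : E2 => orbit G (join t (zPart x))) (tPart x)

/-- The symmetric tensor `χ = (dh₁₁ dh₂₂ - dh₁₂ dh₁₂) / det h` on the orbit space. -/
def chi (x : E4) : Matrix (Fin 2) (Fin 2) ℝ :=
  Matrix.of fun i j =>
    let D : Fin 2 → Fin 2 → Fin 2 → ℝ := fun i k l =>
      partialDeriv (Fin.castAdd 2 i) (fun y => h G y k l) x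
    (D i 0 0 * D j 1 1 + D j 0 0 * D i 1 1 - 2 * (D i 0 1 * D j 0 1)) / (2 * (h G x).det)

/-- `C_χ = χ_ij g̃^ij`. -/
def Cchi (x : E4) : ℝ := ∑ i, ∑ j, chi G x i j * (orbit G x)⁻¹ i j

/-- The components `𝒞ᵏ = (∂_{t²} f₁ᵏ - ∂_{t¹} f₂ᵏ) / √|det g̃|` of the curvature vector field. -/
def curvVector (x : E4) (k : Fin 2) : ℝ :=
  (partialDeriv (Fin.castAdd 2 1) (fun y => fUp G y 0 k) x
    - partialDeriv (Fin.castAdd 2 0) (fun y => fUp G y 1 k) x) / √|(orbit G x).det|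

/-- `ℓ_𝒞 = g(𝒞, 𝒞)`. -/
def ellC (x : E4) : ℝ := ∑ k, ∑ l, h G x k l * curvVector G x k * curvVector G x l

end Adapted

/-- The horizontal vectors `e_i = ∂/∂tⁱ - f_i^k ∂/∂zᵏ`, which span `Ξ^⊥` in adapted coordinates. -/
def horizontalFrame {M : Type*} [TopologicalSpace M] [ChartedSpace E4 M]
    (g : PseudoRiemannianMetric M) (φ : OpenPartialHomeomorph M E4) (p : M) (i : Fin 2) :
    TangentSpace 𝓘(ℝ, E4) p :=
  coordVector φ p (Fin.castAdd 2 i)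
    - ∑ k, Adapted.fUp (g.components φ) (φ p) i k • coordVector φ p (Fin.natAdd 2 k)

end

noncomputable section

/-! ### Partial derivatives of smooth functions -/

section PartialDerivatives

variable {n : ℕ} {U : Set (EuclideanSpace ℝ (Fin n))} {x : EuclideanSpace ℝ (Fin n)}

/-! The equality K(Ξ) = K(Ξ^⊥) is linear algebra at a point. Trace the Ricci tensor over one of two
complementary orthogonal nondegenerate planes. The result is twice the sectional curvature of that
plane plus a mixed term, in which the curvature is contracted over both planes. The other plane
gives the same mixed term. For an Einstein metric both traces equal 2Λ, so the two sectional
curvatures agree (`IsCoordMetric.coordSectional_eq_of_einstein`). Only the antisymmetry of the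
curvature in each index pair enters. Arbitrary bases with their inverse Gram matrices replace
orthonormal frames, so the signature plays no role (`ricci_eq_of_frames`).

For the explicit formulas, the horizontal fields e_i are frozen at the point x and become constant
coordinate fields. Constant fields commute, so the curvature at x is a derivative of Christoffel
symbols of the first kind plus products of such symbols contracted with g̃⁻¹ and h⁻¹
(`riemannForm_adapted`). The Killing equation makes all metric coefficients independent of z.

On the vertical plane the purely vertical symbols vanish, because the orbits are flat. Only the
second fundamental form -½ ∂_i h_kl is left, and it produces C_χ (`coordSectional_vertical`).

On the horizontal plane, the product of two frozen fields is g̃_ij plus an error vanishing to second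
order at x. The g̃ part reproduces the curvature of the orbit metric. The second derivatives of the
error and the vertical symbols combine into the O'Neill term with factor -3/4
(`riemannForm_horizontal`). The relation among C_ric, C_χ and ℓ_𝒞 is K(Ξ) = K(Ξ^⊥) written out in
these formulas. -/

theorem contDiffOn_partialDeriv {F : EuclideanSpace ℝ (Fin n) → ℝ} (hU : IsOpen U)
    (hF : ContDiffOn ℝ ∞ F U) (i : Fin n) : ContDiffOn ℝ ∞ (partialDeriv i F) U :=
  (hF.fderiv_of_isOpen hU (m := ∞) (by simp)).clm_apply contDiffOn_const

theorem ContDiffOn.differentiableAt_of_isOpen {F : EuclideanSpace ℝ (Fin n) → ℝ}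
    (hF : ContDiffOn ℝ ∞ F U) (hU : IsOpen U) (hx : x ∈ U) : DifferentiableAt ℝ F x :=
  (hF.contDiffAt (hU.mem_nhds hx)).differentiableAt (by simp)

theorem partialDeriv_congr {F H : EuclideanSpace ℝ (Fin n) → ℝ} (hU : IsOpen U)
    (h : ∀ y ∈ U, F y = H y) (hx : x ∈ U) (i : Fin n) :
    partialDeriv i F x = partialDeriv i H x := by
  have : F =ᶠ[nhds x] H := Filter.eventually_of_mem (hU.mem_nhds hx) h
  simp only [partialDeriv, this.fderiv_eq]

theorem partialDeriv_add {F H : EuclideanSpace ℝ (Fin n) → ℝ} (hF : DifferentiableAt ℝ F x)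
    (hH : DifferentiableAt ℝ H x) (i : Fin n) :
    partialDeriv i (fun y => F y + H y) x = partialDeriv i F x + partialDeriv i H x := by
  simp [partialDeriv, fderiv_fun_add hF hH]

theorem partialDeriv_sub {F H : EuclideanSpace ℝ (Fin n) → ℝ} (hF : DifferentiableAt ℝ F x)
    (hH : DifferentiableAt ℝ H x) (i : Fin n) :
    partialDeriv i (fun y => F y - H y) x = partialDeriv i F x - partialDeriv i H x := by
  simp [partialDeriv, fderiv_fun_sub hF hH]

theorem partialDeriv_mul {F H : EuclideanSpace ℝ (Fin n) → ℝ} (hF : DifferentiableAt ℝ F x)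
    (hH : DifferentiableAt ℝ H x) (i : Fin n) :
    partialDeriv i (fun y => F y * H y) x
      = partialDeriv i F x * H x + F x * partialDeriv i H x := by
  simp [partialDeriv, fderiv_fun_mul hF hH]; ring

theorem partialDeriv_const_mul {F : EuclideanSpace ℝ (Fin n) → ℝ} (hF : DifferentiableAt ℝ F x)
    (c : ℝ) (i : Fin n) :
    partialDeriv i (fun y => c * F y) x = c * partialDeriv i F x := by
  simp [partialDeriv, fderiv_const_mul hF]

theorem partialDeriv_sum {ι : Type*} {s : Finset ι} {F : ι → EuclideanSpace ℝ (Fin n) → ℝ}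
    (hF : ∀ a ∈ s, DifferentiableAt ℝ (F a) x) (i : Fin n) :
    partialDeriv i (fun y => ∑ a ∈ s, F a y) x = ∑ a ∈ s, partialDeriv i (F a) x := by
  simp [partialDeriv, fderiv_fun_sum hF]

theorem partialDeriv_comm {F : EuclideanSpace ℝ (Fin n) → ℝ} (hU : IsOpen U)
    (hF : ContDiffOn ℝ ∞ F U) (hx : x ∈ U) (i j : Fin n) :
    partialDeriv i (partialDeriv j F) x = partialDeriv j (partialDeriv i F) x := by
  have hF' : DifferentiableAt ℝ (fderiv ℝ F) x :=
    ((hF.fderiv_of_isOpen hU (m := ∞) (by simp)).contDiffAt (hU.mem_nhds hx)).differentiableAt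
      (by simp)
  have key : ∀ k l : Fin n, partialDeriv k (partialDeriv l F) x
      = fderiv ℝ (fderiv ℝ F) x (EuclideanSpace.single k 1) (EuclideanSpace.single l 1) := by
    intro k l
    have : fderiv ℝ (fun y => fderiv ℝ F y (EuclideanSpace.single l 1)) x
        = (fderiv ℝ (fderiv ℝ F) x).flip (EuclideanSpace.single l 1) := by
      simpa using fderiv_clm_apply hF' (differentiableAt_const (EuclideanSpace.single l (1 : ℝ)))
    show fderiv ℝ (fun y => fderiv ℝ F y (EuclideanSpace.single l 1)) x _ = _
    rw [this]; rfl
  rw [key, key]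
  exact ((hF.contDiffAt (hU.mem_nhds hx)).isSymmSndFDerivAt
    (by simpa using ENat.LEInfty.out)).eq _ _

end PartialDerivatives

/-! ### The curvature tensor with all indices lowered -/

theorem contDiffOn_det {E : Type*} [NormedAddCommGroup E] [NormedSpace ℝ E] {n : ℕ} {U : Set E}
    {G : E → Matrix (Fin n) (Fin n) ℝ} (hG : ∀ i j, ContDiffOn ℝ ∞ (fun x => G x i j) U) :
    ContDiffOn ℝ ∞ (fun x => (G x).det) U := by
  simp only [Matrix.det_apply']
  exact ContDiffOn.sum fun σ _ => contDiffOn_const.mul (contDiffOn_prod fun i _ => hG _ _)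

theorem contDiffOn_matrix_inv {E : Type*} [NormedAddCommGroup E] [NormedSpace ℝ E] {n : ℕ}
    {U : Set E} {G : E → Matrix (Fin n) (Fin n) ℝ}
    (hG : ∀ i j, ContDiffOn ℝ ∞ (fun x => G x i j) U) (hdet : ∀ x ∈ U, (G x).det ≠ 0)
    (i j : Fin n) : ContDiffOn ℝ ∞ (fun x => (G x)⁻¹ i j) U := by
  simp only [Matrix.inv_def, Matrix.smul_apply, Ring.inverse_eq_inv', smul_eq_mul,
    Matrix.adjugate_apply]
  -- Cramer's rule: an adjugate entry is the determinant of G with row `j` replaced by a constant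
  -- basis vector, so its entries are smooth too.
  refine ((contDiffOn_det hG).inv hdet).mul (contDiffOn_det fun a b => ?_)
  by_cases h : a = j
  · subst h; simpa using contDiffOn_const
  · simpa [Matrix.updateRow_ne h] using hG a b

/-- `G` is the matrix of components of a smooth pseudo-Riemannian metric on the open set `U`. -/
structure IsCoordMetric {n : ℕ} (U : Set (EuclideanSpace ℝ (Fin n)))
    (G : EuclideanSpace ℝ (Fin n) → Matrix (Fin n) (Fin n) ℝ) : Prop where
  isOpen : IsOpen U
  smooth : ∀ i j, ContDiffOn ℝ ∞ (fun x => G x i j) U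
  symm : ∀ x ∈ U, ∀ i j, G x i j = G x j i
  det_ne_zero : ∀ x ∈ U, (G x).det ≠ 0

/-- The Christoffel symbol of the first kind `Γₗᵢⱼ`. -/
def christoffelLow {n : ℕ} (G : EuclideanSpace ℝ (Fin n) → Matrix (Fin n) (Fin n) ℝ)
    (l i j : Fin n) (x : EuclideanSpace ℝ (Fin n)) : ℝ :=
  (1 / 2) * (partialDeriv i (fun y => G y l j) x + partialDeriv j (fun y => G y l i) x
      - partialDeriv l (fun y => G y i j) x)

/-- The component `Rₗₖᵢⱼ = g(R(∂ᵢ, ∂ⱼ) ∂ₖ, ∂ₗ)`. -/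
def riemannLow {n : ℕ} (G : EuclideanSpace ℝ (Fin n) → Matrix (Fin n) (Fin n) ℝ)
    (l k i j : Fin n) (x : EuclideanSpace ℝ (Fin n)) : ℝ :=
  ∑ m, G x l m * riemann G m k i j x

namespace IsCoordMetric

variable {n : ℕ} {U : Set (EuclideanSpace ℝ (Fin n))}
  {G : EuclideanSpace ℝ (Fin n) → Matrix (Fin n) (Fin n) ℝ} {x : EuclideanSpace ℝ (Fin n)}

theorem inv_symm (hG : IsCoordMetric U G) (hx : x ∈ U) (i j : Fin n) :
    (G x)⁻¹ i j = (G x)⁻¹ j i := by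
  have h : (G x).transpose = G x := Matrix.ext fun a b => hG.symm x hx b a
  calc (G x)⁻¹ i j = ((G x).transpose)⁻¹ i j := by rw [h]
    _ = (G x)⁻¹ j i := by rw [← Matrix.transpose_nonsing_inv]; rfl

theorem sum_mul_inv (hG : IsCoordMetric U G) (hx : x ∈ U) (i j : Fin n) :
    ∑ m, G x i m * (G x)⁻¹ m j = if i = j then 1 else 0 := by
  rw [← Matrix.mul_apply, Matrix.mul_nonsing_inv _ (isUnit_iff_ne_zero.2 (hG.det_ne_zero x hx)),
    Matrix.one_apply]

theorem sum_inv_mul (hG : IsCoordMetric U G) (hx : x ∈ U) (i j : Fin n) :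
    ∑ m, (G x)⁻¹ i m * G x m j = if i = j then 1 else 0 := by
  rw [← Matrix.mul_apply, Matrix.nonsing_inv_mul _ (isUnit_iff_ne_zero.2 (hG.det_ne_zero x hx)),
    Matrix.one_apply]

theorem contDiffOn_christoffelLow (hG : IsCoordMetric U G) (l i j : Fin n) :
    ContDiffOn ℝ ∞ (christoffelLow G l i j) U :=
  contDiffOn_const.mul (((contDiffOn_partialDeriv hG.isOpen (hG.smooth _ _) _).add
    (contDiffOn_partialDeriv hG.isOpen (hG.smooth _ _) _)).sub
    (contDiffOn_partialDeriv hG.isOpen (hG.smooth _ _) _))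

theorem christoffel_eq (k i j : Fin n) (x : EuclideanSpace ℝ (Fin n)) :
    christoffel G k i j x = ∑ l, (G x)⁻¹ k l * christoffelLow G l i j x := by
  simp only [christoffel, christoffelLow, Finset.mul_sum]
  exact Finset.sum_congr rfl fun l _ => by ring

theorem contDiffOn_christoffel (hG : IsCoordMetric U G) (k i j : Fin n) :
    ContDiffOn ℝ ∞ (christoffel G k i j) U := by
  have : christoffel G k i j = fun x => ∑ l, (G x)⁻¹ k l * christoffelLow G l i j x :=
    funext fun x => christoffel_eq k i j x
  rw [this]
  exact ContDiffOn.sum fun l _ =>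
    (contDiffOn_matrix_inv hG.smooth hG.det_ne_zero k l).mul (hG.contDiffOn_christoffelLow l i j)

theorem sum_mul_christoffel (hG : IsCoordMetric U G) (hx : x ∈ U) (l i j : Fin n) :
    ∑ m, G x l m * christoffel G m i j x = christoffelLow G l i j x := by
  simp only [christoffel_eq, Finset.mul_sum]
  rw [Finset.sum_comm]
  simp only [← mul_assoc, ← Finset.sum_mul, hG.sum_mul_inv hx]
  simp

/-- Metric compatibility of the Levi-Civita connection: the two terms are g(∇_i ∂_m, ∂_l) and g(∇_i
∂_l, ∂_m). -/
theorem christoffelLow_add (hG : IsCoordMetric U G) (hx : x ∈ U) (l i m : Fin n) :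
    christoffelLow G l i m x + christoffelLow G m i l x = partialDeriv i (fun y => G y l m) x := by
  simp only [christoffelLow]
  rw [partialDeriv_congr hG.isOpen (fun y hy => hG.symm y hy m l) hx i,
    partialDeriv_congr hG.isOpen (fun y hy => hG.symm y hy i m) hx l,
    partialDeriv_congr hG.isOpen (fun y hy => hG.symm y hy i l) hx m]
  ring

theorem sum_mul_partialDeriv_christoffel (hG : IsCoordMetric U G) (hx : x ∈ U)
    (l i j k : Fin n) :
    ∑ m, G x l m * partialDeriv i (christoffel G m j k) x
      = partialDeriv i (christoffelLow G l j k) x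
        - ∑ m, (christoffelLow G l i m x + christoffelLow G m i l x) * christoffel G m j k x := by
  rw [← partialDeriv_congr hG.isOpen (fun y hy => hG.sum_mul_christoffel hy l j k) hx i,
    partialDeriv_sum, ← Finset.sum_sub_distrib]
  · refine Finset.sum_congr rfl fun m _ => ?_
    rw [partialDeriv_mul ((hG.smooth _ _).differentiableAt_of_isOpen hG.isOpen hx)
      ((hG.contDiffOn_christoffel _ _ _).differentiableAt_of_isOpen hG.isOpen hx),
      hG.christoffelLow_add hx]
    ring
  · exact fun m _ => ((hG.smooth _ _).differentiableAt_of_isOpen hG.isOpen hx).mul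
      ((hG.contDiffOn_christoffel _ _ _).differentiableAt_of_isOpen hG.isOpen hx)

theorem sum_mul_sum_christoffel (hG : IsCoordMetric U G) (hx : x ∈ U) (l i j k : Fin n) :
    ∑ m, G x l m * ∑ p, christoffel G m i p x * christoffel G p j k x
      = ∑ p, christoffelLow G l i p x * christoffel G p j k x := by
  simp only [← hG.sum_mul_christoffel hx, Finset.mul_sum, Finset.sum_mul]
  rw [Finset.sum_comm]
  exact Finset.sum_congr rfl fun m _ => Finset.sum_congr rfl fun p _ => by ring

/-- Moving the metric inside ∂_i Γ costs, by metric compatibility, two products of symbols. One of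
them cancels the quadratic term of the curvature and the other survives with the opposite sign. The
inverse metric then occurs only once, undifferentiated, and can be expanded in any frame. -/
theorem riemannLow_eq (hG : IsCoordMetric U G) (hx : x ∈ U) (l k i j : Fin n) :
    riemannLow G l k i j x
      = partialDeriv i (christoffelLow G l j k) x - partialDeriv j (christoffelLow G l i k) x
        + ∑ m, ∑ p, (G x)⁻¹ m p * (christoffelLow G m j l x * christoffelLow G p i k x
            - christoffelLow G m i l x * christoffelLow G p j k x) := by
  have h1 : riemannLow G l k i j x
      = (∑ m, G x l m * partialDeriv i (christoffel G m j k) x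
        - ∑ m, G x l m * partialDeriv j (christoffel G m i k) x)
        + (∑ m, G x l m * ∑ p, christoffel G m i p x * christoffel G p j k x
        - ∑ m, G x l m * ∑ p, christoffel G m j p x * christoffel G p i k x) := by
    simp only [riemannLow, riemann, ← Finset.sum_sub_distrib, ← Finset.sum_add_distrib]
    refine Finset.sum_congr rfl fun m _ => ?_
    rw [Finset.sum_sub_distrib]; ring
  have h2 : ∀ a b c d : Fin n, ∑ m, ∑ p, (G x)⁻¹ m p *
      (christoffelLow G m a l x * christoffelLow G p b k x)
      = ∑ m, christoffelLow G m a l x * christoffel G m b k x := by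
    intro a b _ _
    simp only [christoffel_eq, Finset.mul_sum]
    exact Finset.sum_congr rfl fun m _ => Finset.sum_congr rfl fun p _ => by ring
  simp only [mul_sub, Finset.sum_sub_distrib]
  rw [h1, hG.sum_mul_partialDeriv_christoffel hx, hG.sum_mul_partialDeriv_christoffel hx,
    hG.sum_mul_sum_christoffel hx, hG.sum_mul_sum_christoffel hx, h2 j i k l, h2 i j k l]
  simp only [add_mul, Finset.sum_add_distrib]
  ring

theorem riemannLow_antisymm_right (l k i j : Fin n) :
    riemannLow G l k i j x = -riemannLow G l k j i x := by
  simp only [riemannLow, riemann, ← Finset.sum_neg_distrib]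
  refine Finset.sum_congr rfl fun m _ => ?_
  simp only [Finset.sum_sub_distrib]
  ring

/-- The quadratic part changes sign because the inverse metric is symmetric. Symmetrizing the
derivative part in l, k leaves ∂_i ∂_j g_lk - ∂_j ∂_i g_lk by metric compatibility, and this is
zero. -/
theorem riemannLow_antisymm_left (hG : IsCoordMetric U G) (hx : x ∈ U) (l k i j : Fin n) :
    riemannLow G l k i j x = -riemannLow G k l i j x := by
  have hd : ∀ a b c d : Fin n, partialDeriv a (christoffelLow G b c d) x
      + partialDeriv a (christoffelLow G d c b) x
      = partialDeriv a (partialDeriv c (fun y => G y b d)) x := by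
    intro a b c d
    rw [← partialDeriv_congr hG.isOpen (fun y hy => hG.christoffelLow_add hy b c d) hx a,
      partialDeriv_add ((hG.contDiffOn_christoffelLow _ _ _).differentiableAt_of_isOpen
        hG.isOpen hx) ((hG.contDiffOn_christoffelLow _ _ _).differentiableAt_of_isOpen
        hG.isOpen hx)]
  have hs : ∀ a b : Fin n, ∑ m, ∑ p, (G x)⁻¹ m p *
      (christoffelLow G m a l x * christoffelLow G p b k x)
      = ∑ m, ∑ p, (G x)⁻¹ m p * (christoffelLow G m b k x * christoffelLow G p a l x) := by
    intro a b
    rw [Finset.sum_comm]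
    refine Finset.sum_congr rfl fun m _ => Finset.sum_congr rfl fun p _ => ?_
    rw [hG.inv_symm hx p m]; ring
  have e1 := hd i l j k
  have e2 := hd j l i k
  have e3 := partialDeriv_comm hG.isOpen (hG.smooth l k) hx i j
  rw [hG.riemannLow_eq hx, hG.riemannLow_eq hx]
  simp only [mul_sub, Finset.sum_sub_distrib]
  rw [hs, hs]
  linarith

theorem ricci_eq (hG : IsCoordMetric U G) (hx : x ∈ U) (j k : Fin n) :
    ricci G j k x = ∑ i, ∑ l, (G x)⁻¹ i l * riemannLow G l k i j x := by
  refine Finset.sum_congr rfl fun i _ => ?_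
  simp only [riemannLow, Finset.mul_sum]
  rw [Finset.sum_comm]
  simp only [← mul_assoc, ← Finset.sum_mul, hG.sum_inv_mul hx]
  simp

end IsCoordMetric

/-! ### Multilinear expansions -/

section Forms

variable {n : ℕ} {U : Set (EuclideanSpace ℝ (Fin n))}
  {G : EuclideanSpace ℝ (Fin n) → Matrix (Fin n) (Fin n) ℝ} {x : EuclideanSpace ℝ (Fin n)}

theorem coordInner_add_left (u u' v : EuclideanSpace ℝ (Fin n)) :
    coordInner G x (u + u') v = coordInner G x u v + coordInner G x u' v := by
  simp only [coordInner, PiLp.add_apply, mul_add, add_mul, Finset.sum_add_distrib]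

theorem coordInner_add_right (u v v' : EuclideanSpace ℝ (Fin n)) :
    coordInner G x u (v + v') = coordInner G x u v + coordInner G x u v' := by
  simp only [coordInner, PiLp.add_apply, mul_add, Finset.sum_add_distrib]

theorem coordInner_smul_left (c : ℝ) (u v : EuclideanSpace ℝ (Fin n)) :
    coordInner G x (c • u) v = c * coordInner G x u v := by
  simp only [coordInner, PiLp.smul_apply, smul_eq_mul, Finset.mul_sum]
  exact Finset.sum_congr rfl fun m _ => Finset.sum_congr rfl fun p _ => by ring

theorem coordInner_smul_right (c : ℝ) (u v : EuclideanSpace ℝ (Fin n)) :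
    coordInner G x u (c • v) = c * coordInner G x u v := by
  simp only [coordInner, PiLp.smul_apply, smul_eq_mul, Finset.mul_sum]
  exact Finset.sum_congr rfl fun m _ => Finset.sum_congr rfl fun p _ => by ring

theorem coordInner_single_right (u : EuclideanSpace ℝ (Fin n)) (r : Fin n) :
    coordInner G x u (EuclideanSpace.single r 1) = ∑ q, u q * G x q r := by
  simp [coordInner, mul_comm]

theorem coordInner_single_single (q r : Fin n) :
    coordInner G x (EuclideanSpace.single q 1) (EuclideanSpace.single r 1) = G x q r := by
  simp [coordInner]

theorem IsCoordMetric.coordInner_symm (hG : IsCoordMetric U G) (hx : x ∈ U)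
    (u v : EuclideanSpace ℝ (Fin n)) : coordInner G x u v = coordInner G x v u := by
  simp only [coordInner]
  rw [Finset.sum_comm]
  exact Finset.sum_congr rfl fun m _ => Finset.sum_congr rfl fun p _ => by
    rw [hG.symm x hx p m]; ring

/-- The number `g(R(a, b) c, d)`. -/
def riemannForm (G : EuclideanSpace ℝ (Fin n) → Matrix (Fin n) (Fin n) ℝ)
    (x d c a b : EuclideanSpace ℝ (Fin n)) : ℝ :=
  coordInner G x (curvatureOp G x a b c) d

theorem IsCoordMetric.riemannForm_eq (hG : IsCoordMetric U G) (hx : x ∈ U)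
    (d c a b : EuclideanSpace ℝ (Fin n)) :
    riemannForm G x d c a b
      = ∑ l, ∑ k, ∑ i, ∑ j, riemannLow G l k i j x * d l * c k * a i * b j := by
  simp only [riemannForm, coordInner, curvatureOp, riemannLow, Finset.mul_sum, Finset.sum_mul]
  -- Iterated sums become one sum over tuples, and the explicit equivalence is the required
  -- permutation of the summation indices. The same device recurs below.
  simp only [← Fintype.sum_prod_type']
  refine Fintype.sum_equiv
    (⟨fun q => (q.2.1, q.2.2.1, q.2.2.2.1, q.2.2.2.2, q.1),
      fun q => (q.2.2.2.2, q.1, q.2.1, q.2.2.1, q.2.2.2.1), fun _ => rfl, fun _ => rfl⟩ :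
      (Fin n × Fin n × Fin n × Fin n × Fin n) ≃ (Fin n × Fin n × Fin n × Fin n × Fin n)) _ _ ?_
  rintro ⟨p, l, k, i, j⟩
  simp only [Equiv.coe_fn_mk]
  rw [hG.symm x hx p l]
  ring

theorem IsCoordMetric.riemannForm_swap_right (hG : IsCoordMetric U G) (hx : x ∈ U)
    (d c a b : EuclideanSpace ℝ (Fin n)) :
    riemannForm G x d c a b = -riemannForm G x d c b a := by
  rw [hG.riemannForm_eq hx, hG.riemannForm_eq hx]
  simp only [← Finset.sum_neg_distrib]
  refine Finset.sum_congr rfl fun l _ => Finset.sum_congr rfl fun k _ => ?_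
  rw [Finset.sum_comm]
  refine Finset.sum_congr rfl fun i _ => Finset.sum_congr rfl fun j _ => ?_
  rw [IsCoordMetric.riemannLow_antisymm_right]
  ring

theorem IsCoordMetric.riemannForm_swap_left (hG : IsCoordMetric U G) (hx : x ∈ U)
    (d c a b : EuclideanSpace ℝ (Fin n)) :
    riemannForm G x d c a b = -riemannForm G x c d a b := by
  rw [hG.riemannForm_eq hx, hG.riemannForm_eq hx, Finset.sum_comm]
  simp only [← Finset.sum_neg_distrib]
  refine Finset.sum_congr rfl fun l _ => Finset.sum_congr rfl fun k _ =>
    Finset.sum_congr rfl fun i _ => Finset.sum_congr rfl fun j _ => ?_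
  rw [hG.riemannLow_antisymm_left hx]
  ring

/-- The inverse metric in terms of bases of two complementary orthogonal subspaces. -/
theorem IsCoordMetric.inv_eq_of_frames (hG : IsCoordMetric U G) (hx : x ∈ U)
    {ι κ : Type*} [Fintype ι] [Fintype κ] [DecidableEq ι] [DecidableEq κ]
    {u : ι → EuclideanSpace ℝ (Fin n)} {w : κ → EuclideanSpace ℝ (Fin n)}
    (horth : ∀ i j, coordInner G x (u i) (w j) = 0) {A : Matrix ι ι ℝ} {C : Matrix κ κ ℝ}
    (hA : A * Matrix.of (fun i j => coordInner G x (u i) (u j)) = 1)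
    (hC : C * Matrix.of (fun i j => coordInner G x (w i) (w j)) = 1)
    (hspan : ⊤ ≤ Submodule.span ℝ (Set.range u ∪ Set.range w)) (p q : Fin n) :
    (G x)⁻¹ p q = ∑ i, ∑ j, A i j * u i p * u j q + ∑ i, ∑ j, C i j * w i p * w j q := by
  -- The orthogonal projections onto the two subspaces add up to the identity: this is checked on
  -- the frame vectors and extended by linearity. Applied to coordinate vectors, it says that `H`
  -- below is a left inverse of `G x`.
  have key : ∀ v : EuclideanSpace ℝ (Fin n), ∀ p,
      ∑ i, ∑ j, A i j * u i p * coordInner G x (u j) v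
        + ∑ i, ∑ j, C i j * w i p * coordInner G x (w j) v = v p := by
    intro v
    induction hspan (Submodule.mem_top : v ∈ ⊤) using Submodule.span_induction with
    | mem v hv =>
      intro p
      rcases hv with ⟨a, rfl⟩ | ⟨a, rfl⟩
      · have h0 : ∀ j, coordInner G x (w j) (u a) = 0 := fun j => by
          rw [hG.coordInner_symm hx, horth]
        have h1 : ∀ i, ∑ j, A i j * coordInner G x (u j) (u a) = if i = a then 1 else 0 := by
          intro i
          simpa [Matrix.mul_apply, Matrix.one_apply] using congrFun (congrFun hA i) a
        simp only [h0, mul_zero, Finset.sum_const_zero, add_zero, mul_right_comm _ (u _ p),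
          ← Finset.sum_mul, h1]
        simp
      · have h1 : ∀ i, ∑ j, C i j * coordInner G x (w j) (w a) = if i = a then 1 else 0 := by
          intro i
          simpa [Matrix.mul_apply, Matrix.one_apply] using congrFun (congrFun hC i) a
        simp only [horth, mul_zero, Finset.sum_const_zero, zero_add, mul_right_comm _ (w _ p),
          ← Finset.sum_mul, h1]
        simp
    | zero =>
      intro p
      simp [coordInner]
    | add v v' _ _ h h' =>
      intro p
      rw [PiLp.add_apply, ← h p, ← h' p]
      simp only [coordInner_add_right, mul_add, Finset.sum_add_distrib]
      ring
    | smul c v _ h =>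
      intro p
      rw [PiLp.smul_apply, ← h p]
      simp only [coordInner_smul_right, smul_eq_mul, mul_add, Finset.mul_sum]
      congr 1 <;>
      exact Finset.sum_congr rfl fun m _ => Finset.sum_congr rfl fun p _ => by ring
  let H : Matrix (Fin n) (Fin n) ℝ := Matrix.of fun p q =>
    ∑ i, ∑ j, A i j * u i p * u j q + ∑ i, ∑ j, C i j * w i p * w j q
  have hH : H * G x = 1 := by
    ext p r
    rw [Matrix.mul_apply, Matrix.one_apply]
    have h := key (EuclideanSpace.single r 1) p
    simp only [coordInner_single_right, Finset.mul_sum] at h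
    rw [show (if p = r then (1 : ℝ) else 0) = (EuclideanSpace.single r (1 : ℝ)) p by
      simp, ← h]
    simp only [H, Matrix.of_apply, add_mul, Finset.sum_add_distrib, Finset.sum_mul]
    congr 1
    · rw [Finset.sum_comm]
      refine Finset.sum_congr rfl fun i _ => ?_
      rw [Finset.sum_comm]
      exact Finset.sum_congr rfl fun m _ => Finset.sum_congr rfl fun p _ => by ring
    · rw [Finset.sum_comm]
      refine Finset.sum_congr rfl fun i _ => ?_
      rw [Finset.sum_comm]
      exact Finset.sum_congr rfl fun m _ => Finset.sum_congr rfl fun p _ => by ring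
  rw [Matrix.inv_eq_left_inv hH]
  rfl

theorem sum_mul_bilinear {ι : Type*} [Fintype ι] (A : Matrix ι ι ℝ)
    (u : ι → EuclideanSpace ℝ (Fin n)) (t : Fin n → Fin n → ℝ) :
    ∑ m, ∑ p, (∑ i, ∑ j, A i j * u i m * u j p) * t m p
      = ∑ i, ∑ j, A i j * ∑ m, ∑ p, t m p * u i m * u j p := by
  simp only [Finset.sum_mul, Finset.mul_sum]
  simp only [← Fintype.sum_prod_type']
  refine Fintype.sum_equiv
    (⟨fun q => (q.2.2.1, q.2.2.2, q.1, q.2.1), fun q => (q.2.2.1, q.2.2.2, q.1, q.2.1),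
      fun _ => rfl, fun _ => rfl⟩ :
      (Fin n × Fin n × ι × ι) ≃ (ι × ι × Fin n × Fin n)) _ _ ?_
  rintro ⟨m, p, i, j⟩
  simp only [Equiv.coe_fn_mk]
  ring

/-- The contraction of a bilinear form with the inverse metric in terms of bases of two
complementary orthogonal subspaces. -/
theorem IsCoordMetric.contraction_eq_of_frames (hG : IsCoordMetric U G) (hx : x ∈ U)
    {ι κ : Type*} [Fintype ι] [Fintype κ] [DecidableEq ι] [DecidableEq κ]
    {u : ι → EuclideanSpace ℝ (Fin n)} {w : κ → EuclideanSpace ℝ (Fin n)}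
    (horth : ∀ i j, coordInner G x (u i) (w j) = 0) {A : Matrix ι ι ℝ} {C : Matrix κ κ ℝ}
    (hA : A * Matrix.of (fun i j => coordInner G x (u i) (u j)) = 1)
    (hC : C * Matrix.of (fun i j => coordInner G x (w i) (w j)) = 1)
    (hspan : ⊤ ≤ Submodule.span ℝ (Set.range u ∪ Set.range w)) (t : Fin n → Fin n → ℝ) :
    ∑ m, ∑ p, (G x)⁻¹ m p * t m p
      = ∑ i, ∑ j, A i j * (∑ m, ∑ p, t m p * u i m * u j p)
        + ∑ i, ∑ j, C i j * (∑ m, ∑ p, t m p * w i m * w j p) := by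
  simp only [hG.inv_eq_of_frames hx horth hA hC hspan, add_mul, Finset.sum_add_distrib,
    sum_mul_bilinear]

theorem IsCoordMetric.ricci_eq_of_frames (hG : IsCoordMetric U G) (hx : x ∈ U)
    {ι κ : Type*} [Fintype ι] [Fintype κ] [DecidableEq ι] [DecidableEq κ]
    {u : ι → EuclideanSpace ℝ (Fin n)} {w : κ → EuclideanSpace ℝ (Fin n)}
    (horth : ∀ i j, coordInner G x (u i) (w j) = 0) {A : Matrix ι ι ℝ} {C : Matrix κ κ ℝ}
    (hA : A * Matrix.of (fun i j => coordInner G x (u i) (u j)) = 1)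
    (hC : C * Matrix.of (fun i j => coordInner G x (w i) (w j)) = 1)
    (hspan : ⊤ ≤ Submodule.span ℝ (Set.range u ∪ Set.range w))
    (a b : EuclideanSpace ℝ (Fin n)) :
    ∑ j, ∑ k, ricci G j k x * a j * b k
      = ∑ p, ∑ q, A p q * riemannForm G x (u q) b (u p) a
        + ∑ p, ∑ q, C p q * riemannForm G x (w q) b (w p) a := by
  have h1 : ∑ j, ∑ k, ricci G j k x * a j * b k
      = ∑ i, ∑ l, (G x)⁻¹ i l * ∑ k, ∑ j, riemannLow G l k i j x * b k * a j := by
    simp only [hG.ricci_eq hx, Finset.sum_mul, Finset.mul_sum]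
    simp only [← Fintype.sum_prod_type']
    refine Fintype.sum_equiv
      (⟨fun q => (q.2.2.1, q.2.2.2, q.2.1, q.1), fun q => (q.2.2.2, q.2.2.1, q.1, q.2.1),
        fun _ => rfl, fun _ => rfl⟩ :
        (Fin n × Fin n × Fin n × Fin n) ≃ (Fin n × Fin n × Fin n × Fin n)) _ _ ?_
    rintro ⟨j, k, i, l⟩
    simp only [Equiv.coe_fn_mk]
    ring
  have h2 : ∀ d c : EuclideanSpace ℝ (Fin n), ∑ i, ∑ l,
      (∑ k, ∑ j, riemannLow G l k i j x * b k * a j) * c i * d l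
      = riemannForm G x d b c a := by
    intro d c
    rw [hG.riemannForm_eq hx]
    simp only [Finset.sum_mul]
    simp only [← Fintype.sum_prod_type']
    refine Fintype.sum_equiv
      (⟨fun q => (q.2.1, q.2.2.1, q.1, q.2.2.2), fun q => (q.2.2.1, q.1, q.2.1, q.2.2.2),
        fun _ => rfl, fun _ => rfl⟩ :
        (Fin n × Fin n × Fin n × Fin n) ≃ (Fin n × Fin n × Fin n × Fin n)) _ _ ?_
    rintro ⟨i, l, k, j⟩
    simp only [Equiv.coe_fn_mk]
    ring
  rw [h1, hG.contraction_eq_of_frames hx horth hA hC hspan]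
  simp only [h2]

/-- In dimension four, complementary orthogonal planes of an Einstein metric have the same
sectional curvature. -/
theorem IsCoordMetric.coordSectional_eq_of_einstein (hG : IsCoordMetric U G) (hx : x ∈ U)
    {Λ : ℝ} (hΛ : ∀ j k, ricci G j k x = Λ * G x j k)
    {u w : Fin 2 → EuclideanSpace ℝ (Fin n)}
    (horth : ∀ i j, coordInner G x (u i) (w j) = 0)
    (hu : coordInner G x (u 0) (u 0) * coordInner G x (u 1) (u 1)
      - coordInner G x (u 0) (u 1) ^ 2 ≠ 0)
    (hw : coordInner G x (w 0) (w 0) * coordInner G x (w 1) (w 1)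
      - coordInner G x (w 0) (w 1) ^ 2 ≠ 0)
    (hspan : ⊤ ≤ Submodule.span ℝ (Set.range u ∪ Set.range w)) :
    coordSectional G x (u 0) (u 1) = coordSectional G x (w 0) (w 1) := by
  -- The inverse Gram matrix is written by the 2×2 adjugate formula so that its scalar factor is the
  -- reciprocal of the denominator in `coordSectional`.
  have hinv : ∀ v : Fin 2 → EuclideanSpace ℝ (Fin n),
      coordInner G x (v 0) (v 0) * coordInner G x (v 1) (v 1)
        - coordInner G x (v 0) (v 1) ^ 2 ≠ 0 →
      (coordInner G x (v 0) (v 0) * coordInner G x (v 1) (v 1)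
        - coordInner G x (v 0) (v 1) ^ 2)⁻¹ •
        !![coordInner G x (v 1) (v 1), -coordInner G x (v 0) (v 1);
          -coordInner G x (v 0) (v 1), coordInner G x (v 0) (v 0)]
        * Matrix.of (fun i j => coordInner G x (v i) (v j)) = 1 := by
    intro v hv
    have hs := hG.coordInner_symm hx (v 1) (v 0)
    ext i j
    fin_cases i <;> fin_cases j <;>
      simp [Matrix.mul_apply, Fin.sum_univ_two, hs] <;> field_simp <;> ring
  have hric : ∀ a b : EuclideanSpace ℝ (Fin n),
      ∑ j, ∑ k, ricci G j k x * a j * b k = Λ * coordInner G x a b := by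
    intro a b
    simp only [hΛ, coordInner, Finset.mul_sum]
    exact Finset.sum_congr rfl fun m _ => Finset.sum_congr rfl fun p _ => by ring
  have key := fun a b => (hric a b).symm.trans
    (hG.ricci_eq_of_frames hx horth (hinv u hu) (hinv w hw) hspan a b)
  have hzr : ∀ d c a, riemannForm G x d c a a = 0 := fun d c a => by
    linarith [hG.riemannForm_swap_right hx d c a a]
  have hzl : ∀ c a b, riemannForm G x c c a b = 0 := fun c a b => by
    linarith [hG.riemannForm_swap_left hx c c a b]
  -- Antisymmetry in both pairs identifies the mixed terms of the two traces; neither Bianchi nor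
  -- the exchange of pairs is needed.
  have hmix : ∀ i j k l, riemannForm G x (w i) (u j) (w k) (u l)
      = riemannForm G x (u j) (w i) (u l) (w k) := fun i j k l => by
    rw [hG.riemannForm_swap_left hx, hG.riemannForm_swap_right hx, neg_neg]
  have hr := fun d c (v : Fin 2 → EuclideanSpace ℝ (Fin n)) =>
    hG.riemannForm_swap_right hx d c (v 1) (v 0)
  have hl := fun a b (v : Fin 2 → EuclideanSpace ℝ (Fin n)) =>
    hG.riemannForm_swap_left hx (v 1) (v 0) a b
  simp only [Fin.sum_univ_two, Matrix.smul_apply, smul_eq_mul, Matrix.of_apply, Matrix.cons_val',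
    Matrix.cons_val_zero, Matrix.cons_val_one, Matrix.cons_val_fin_one] at key
  have k1 := key (u 0) (u 0)
  have k2 := key (u 0) (u 1)
  have k3 := key (u 1) (u 0)
  have k4 := key (u 1) (u 1)
  have m1 := key (w 0) (w 0)
  have m2 := key (w 0) (w 1)
  have m3 := key (w 1) (w 0)
  have m4 := key (w 1) (w 1)
  clear key
  simp only [hzr, hzl, hmix, hr _ _ u, hr _ _ w, hl _ _ u, hl _ _ w,
    hG.coordInner_symm hx (u 1) (u 0), hG.coordInner_symm hx (w 1) (w 0)] at k1 k2 k3 k4 m1 m2 m3 m4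
  show riemannForm G x (u 0) (u 1) (u 0) (u 1) / _ = riemannForm G x (w 0) (w 1) (w 0) (w 1) / _
  generalize coordInner G x (u 0) (u 0) = a₀ at *
  generalize coordInner G x (u 0) (u 1) = a₁ at *
  generalize coordInner G x (u 1) (u 1) = a₂ at *
  generalize coordInner G x (w 0) (w 0) = c₀ at *
  generalize coordInner G x (w 0) (w 1) = c₁ at *
  generalize coordInner G x (w 1) (w 1) = c₂ at *
  have hu' : (a₀ * a₂ - a₁ ^ 2)⁻¹ * (a₀ * a₂ - a₁ ^ 2) = 1 := inv_mul_cancel₀ hu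
  have hw' : (c₀ * c₂ - c₁ ^ 2)⁻¹ * (c₀ * c₂ - c₁ ^ 2) = 1 := inv_mul_cancel₀ hw
  rw [div_eq_mul_inv, div_eq_mul_inv]
  generalize (a₀ * a₂ - a₁ ^ 2)⁻¹ = r at *
  generalize (c₀ * c₂ - c₁ ^ 2)⁻¹ = s at *
  generalize riemannForm G x (u 0) (u 1) (u 0) (u 1) = P at *
  generalize riemannForm G x (w 0) (w 1) (w 0) (w 1) = Q at *
  -- The brackets are the Ricci traces over the two planes, weighted by the adjugate Gram matrices.
  -- The mixed terms cancel in the difference, and `hu'`, `hw'` remove the remaining products of a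
  -- Gram determinant with its reciprocal.
  linear_combination (-(r / 2)) * (a₂ * k1 - a₁ * k2 - a₁ * k3 + a₀ * k4)
    + (s / 2) * (c₂ * m1 - c₁ * m2 - c₁ * m3 + c₀ * m4) + (Λ - r * P) * hu' - (Λ - s * Q) * hw'

end Forms

/-! ### Christoffel symbols evaluated on constant vector fields -/

section Directional

variable {n : ℕ} {U : Set (EuclideanSpace ℝ (Fin n))}
  {G : EuclideanSpace ℝ (Fin n) → Matrix (Fin n) (Fin n) ℝ} {x : EuclideanSpace ℝ (Fin n)}

/-- The derivative of `F` at `x` in the direction `v`. -/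
def directionalDeriv (v : EuclideanSpace ℝ (Fin n)) (F : EuclideanSpace ℝ (Fin n) → ℝ)
    (x : EuclideanSpace ℝ (Fin n)) : ℝ :=
  ∑ i, v i * partialDeriv i F x

/-- The Christoffel symbols of the first kind as a trilinear form. -/
def christoffelForm (G : EuclideanSpace ℝ (Fin n) → Matrix (Fin n) (Fin n) ℝ)
    (m a b x : EuclideanSpace ℝ (Fin n)) : ℝ :=
  ∑ l, ∑ i, ∑ j, christoffelLow G l i j x * m l * a i * b j

theorem IsCoordMetric.contDiffOn_coordInner (hG : IsCoordMetric U G)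
    (u v : EuclideanSpace ℝ (Fin n)) : ContDiffOn ℝ ∞ (fun y => coordInner G y u v) U :=
  ContDiffOn.sum fun i _ => ContDiffOn.sum fun j _ =>
    ((hG.smooth i j).mul contDiffOn_const).mul contDiffOn_const

theorem IsCoordMetric.partialDeriv_coordInner (hG : IsCoordMetric U G) (hx : x ∈ U)
    (u v : EuclideanSpace ℝ (Fin n)) (k : Fin n) :
    partialDeriv k (fun y => coordInner G y u v) x
      = ∑ i, ∑ j, partialDeriv k (fun y => G y i j) x * u i * v j := by
  have hd : ∀ i j, DifferentiableAt ℝ (fun y => G y i j) x := fun i j =>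
    (hG.smooth i j).differentiableAt_of_isOpen hG.isOpen hx
  simp only [coordInner]
  rw [partialDeriv_sum fun i _ => DifferentiableAt.fun_sum fun j _ =>
    ((hd i j).mul_const _).mul_const _]
  refine Finset.sum_congr rfl fun i _ => ?_
  rw [partialDeriv_sum fun j _ => ((hd i j).mul_const _).mul_const _]
  refine Finset.sum_congr rfl fun j _ => ?_
  have : (fun y => G y i j * u i * v j) = fun y => (u i * v j) * G y i j := by
    funext y; ring
  rw [this, partialDeriv_const_mul (hd i j)]
  ring

/-- The Koszul formula; constant fields commute, so the bracket terms are absent. -/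
theorem IsCoordMetric.christoffelForm_eq (hG : IsCoordMetric U G) (hx : x ∈ U)
    (m a b : EuclideanSpace ℝ (Fin n)) :
    christoffelForm G m a b x
      = (1 / 2) * (directionalDeriv a (fun y => coordInner G y m b) x
        + directionalDeriv b (fun y => coordInner G y m a) x
        - directionalDeriv m (fun y => coordInner G y a b) x) := by
  simp only [christoffelForm, directionalDeriv, hG.partialDeriv_coordInner hx, christoffelLow]
  have h1 : ∑ i, a i * ∑ l, ∑ j, partialDeriv i (fun y => G y l j) x * m l * b j
      = ∑ l, ∑ i, ∑ j, partialDeriv i (fun y => G y l j) x * m l * a i * b j := by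
    simp only [Finset.mul_sum]
    rw [Finset.sum_comm]
    exact Finset.sum_congr rfl fun _ _ => Finset.sum_congr rfl fun _ _ =>
      Finset.sum_congr rfl fun _ _ => by ring
  have h2 : ∑ j, b j * ∑ l, ∑ i, partialDeriv j (fun y => G y l i) x * m l * a i
      = ∑ l, ∑ i, ∑ j, partialDeriv j (fun y => G y l i) x * m l * a i * b j := by
    simp only [Finset.mul_sum]
    rw [Finset.sum_comm]
    refine Finset.sum_congr rfl fun _ _ => ?_
    rw [Finset.sum_comm]
    exact Finset.sum_congr rfl fun _ _ => Finset.sum_congr rfl fun _ _ => by ring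
  have h3 : ∑ l, m l * ∑ i, ∑ j, partialDeriv l (fun y => G y i j) x * a i * b j
      = ∑ l, ∑ i, ∑ j, partialDeriv l (fun y => G y i j) x * m l * a i * b j := by
    simp only [Finset.mul_sum]
    exact Finset.sum_congr rfl fun _ _ => Finset.sum_congr rfl fun _ _ =>
      Finset.sum_congr rfl fun _ _ => by ring
  rw [h1, h2, h3]
  simp only [← Finset.sum_add_distrib, ← Finset.sum_sub_distrib, Finset.mul_sum]
  exact Finset.sum_congr rfl fun _ _ => Finset.sum_congr rfl fun _ _ =>
      Finset.sum_congr rfl fun _ _ => by ring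

theorem IsCoordMetric.directionalDeriv_christoffelForm (hG : IsCoordMetric U G) (hx : x ∈ U)
    (d c a b : EuclideanSpace ℝ (Fin n)) :
    directionalDeriv a (christoffelForm G d b c) x
      = ∑ l, ∑ k, ∑ i, ∑ j,
        partialDeriv i (christoffelLow G l j k) x * d l * c k * a i * b j := by
  have hd : ∀ l i j, DifferentiableAt ℝ (christoffelLow G l i j) x := fun l i j =>
    (hG.contDiffOn_christoffelLow l i j).differentiableAt_of_isOpen hG.isOpen hx
  have hp : ∀ i, partialDeriv i (christoffelForm G d b c) x
      = ∑ l, ∑ j, ∑ k, d l * b j * c k * partialDeriv i (christoffelLow G l j k) x := by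
    intro i
    have : christoffelForm G d b c
        = fun y => ∑ l, ∑ j, ∑ k, d l * b j * c k * christoffelLow G l j k y := by
      funext y
      exact Finset.sum_congr rfl fun _ _ => Finset.sum_congr rfl fun _ _ =>
        Finset.sum_congr rfl fun _ _ => by ring
    rw [this, partialDeriv_sum fun l _ => DifferentiableAt.fun_sum fun j _ =>
      DifferentiableAt.fun_sum fun k _ => (hd l j k).const_mul _]
    refine Finset.sum_congr rfl fun l _ => ?_
    rw [partialDeriv_sum fun j _ => DifferentiableAt.fun_sum fun k _ => (hd l j k).const_mul _]
    refine Finset.sum_congr rfl fun j _ => ?_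
    rw [partialDeriv_sum fun k _ => (hd l j k).const_mul _]
    exact Finset.sum_congr rfl fun k _ => partialDeriv_const_mul (hd l j k) _ _
  simp only [directionalDeriv, hp, Finset.mul_sum]
  simp only [← Fintype.sum_prod_type']
  refine Fintype.sum_equiv
    (⟨fun q => (q.2.1, q.2.2.2, q.1, q.2.2.1), fun q => (q.2.2.1, q.1, q.2.2.2, q.2.1),
      fun _ => rfl, fun _ => rfl⟩ :
      (Fin n × Fin n × Fin n × Fin n) ≃ (Fin n × Fin n × Fin n × Fin n)) _ _ ?_
  rintro ⟨i, l, j, k⟩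
  simp only [Equiv.coe_fn_mk]
  ring

theorem sum_christoffelLow_mul (m p : Fin n) (d c a b : EuclideanSpace ℝ (Fin n)) :
    ∑ l, ∑ k, ∑ i, ∑ j,
        christoffelLow G m j l x * christoffelLow G p i k x * d l * c k * a i * b j
      = (∑ j, ∑ l, christoffelLow G m j l x * b j * d l)
        * ∑ i, ∑ k, christoffelLow G p i k x * a i * c k := by
  simp only [Finset.sum_mul, Finset.mul_sum]
  simp only [← Fintype.sum_prod_type']
  refine Fintype.sum_equiv
    (⟨fun q => (q.2.2.1, q.2.1, q.2.2.2, q.1), fun q => (q.2.2.2, q.2.1, q.1, q.2.2.1),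
      fun _ => rfl, fun _ => rfl⟩ :
      (Fin n × Fin n × Fin n × Fin n) ≃ (Fin n × Fin n × Fin n × Fin n)) _ _ ?_
  rintro ⟨l, k, i, j⟩
  simp only [Equiv.coe_fn_mk]
  ring

theorem sum_christoffelLow_mul_eq (u v d c a b : EuclideanSpace ℝ (Fin n)) :
    ∑ m, ∑ p, ((∑ j, ∑ l, christoffelLow G m j l x * b j * d l)
        * ∑ i, ∑ k, christoffelLow G p i k x * a i * c k) * u m * v p
      = christoffelForm G u b d x * christoffelForm G v a c x := by
  rw [christoffelForm, christoffelForm, Finset.sum_mul_sum]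
  refine Finset.sum_congr rfl fun m _ => Finset.sum_congr rfl fun p _ => ?_
  have h : ∀ (q : Fin n) (s : ℝ) (a c : EuclideanSpace ℝ (Fin n)),
      ∑ i, ∑ k, christoffelLow G q i k x * s * a i * c k
        = s * ∑ i, ∑ k, christoffelLow G q i k x * a i * c k := by
    intro q s a c
    simp only [Finset.mul_sum]
    exact Finset.sum_congr rfl fun _ _ => Finset.sum_congr rfl fun _ _ => by ring
  rw [h, h]
  ring

/-- This is `riemannLow_eq` evaluated on constant fields, with the inverse metric split along two
orthogonal subspaces. The frame has to be orthogonal at the single point `x` only, which is what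
permits frozen frames. -/
theorem IsCoordMetric.riemannForm_eq_of_frames (hG : IsCoordMetric U G) (hx : x ∈ U)
    {ι κ : Type*} [Fintype ι] [Fintype κ] [DecidableEq ι] [DecidableEq κ]
    {u : ι → EuclideanSpace ℝ (Fin n)} {w : κ → EuclideanSpace ℝ (Fin n)}
    (horth : ∀ i j, coordInner G x (u i) (w j) = 0) {A : Matrix ι ι ℝ} {C : Matrix κ κ ℝ}
    (hA : A * Matrix.of (fun i j => coordInner G x (u i) (u j)) = 1)
    (hC : C * Matrix.of (fun i j => coordInner G x (w i) (w j)) = 1)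
    (hspan : ⊤ ≤ Submodule.span ℝ (Set.range u ∪ Set.range w))
    (d c a b : EuclideanSpace ℝ (Fin n)) :
    riemannForm G x d c a b
      = directionalDeriv a (christoffelForm G d b c) x
        - directionalDeriv b (christoffelForm G d a c) x
        + ∑ p, ∑ q, A p q *
          (christoffelForm G (u p) b d x * christoffelForm G (u q) a c x
            - christoffelForm G (u p) a d x * christoffelForm G (u q) b c x)
        + ∑ p, ∑ q, C p q *
          (christoffelForm G (w p) b d x * christoffelForm G (w q) a c x
            - christoffelForm G (w p) a d x * christoffelForm G (w q) b c x) := by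
  have h1 : riemannForm G x d c a b
      = directionalDeriv a (christoffelForm G d b c) x
        - directionalDeriv b (christoffelForm G d a c) x
        + ∑ m, ∑ p, (G x)⁻¹ m p *
          ((∑ j, ∑ l, christoffelLow G m j l x * b j * d l)
              * (∑ i, ∑ k, christoffelLow G p i k x * a i * c k)
            - (∑ j, ∑ l, christoffelLow G m j l x * a j * d l)
              * (∑ i, ∑ k, christoffelLow G p i k x * b i * c k)) := by
    have e1 : ∑ l, ∑ k, ∑ i, ∑ j,
        partialDeriv j (christoffelLow G l i k) x * d l * c k * a i * b j
        = directionalDeriv b (christoffelForm G d a c) x := by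
      rw [hG.directionalDeriv_christoffelForm hx]
      refine Finset.sum_congr rfl fun _ _ => Finset.sum_congr rfl fun _ _ => ?_
      rw [Finset.sum_comm]
      exact Finset.sum_congr rfl fun _ _ => Finset.sum_congr rfl fun _ _ => by ring
    have e0 : ∀ m p, (∑ j, ∑ l, christoffelLow G m j l x * b j * d l)
        * ∑ i, ∑ k, christoffelLow G p i k x * a i * c k = ∑ l, ∑ k, ∑ i, ∑ j,
        christoffelLow G m j l x * christoffelLow G p i k x * d l * c k * a i * b j :=
      fun m p => (sum_christoffelLow_mul m p d c a b).symm
    have e2 : ∀ m p, ∑ l, ∑ k, ∑ i, ∑ j,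
        christoffelLow G m i l x * christoffelLow G p j k x * d l * c k * a i * b j
        = (∑ j, ∑ l, christoffelLow G m j l x * a j * d l)
          * ∑ i, ∑ k, christoffelLow G p i k x * b i * c k := by
      intro m p
      rw [← sum_christoffelLow_mul]
      refine Finset.sum_congr rfl fun _ _ => Finset.sum_congr rfl fun _ _ => ?_
      rw [Finset.sum_comm]
      exact Finset.sum_congr rfl fun _ _ => Finset.sum_congr rfl fun _ _ => by ring
    rw [hG.directionalDeriv_christoffelForm hx, ← e1, hG.riemannForm_eq hx]
    simp only [e0, ← e2]
    have e3 : ∑ m, ∑ p, (G x)⁻¹ m p *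
        ((∑ l, ∑ k, ∑ i, ∑ j,
          christoffelLow G m j l x * christoffelLow G p i k x * d l * c k * a i * b j)
        - ∑ l, ∑ k, ∑ i, ∑ j,
          christoffelLow G m i l x * christoffelLow G p j k x * d l * c k * a i * b j)
        = ∑ l, ∑ k, ∑ i, ∑ j, (∑ m, ∑ p, (G x)⁻¹ m p *
          (christoffelLow G m j l x * christoffelLow G p i k x
            - christoffelLow G m i l x * christoffelLow G p j k x)) * d l * c k * a i * b j := by
      simp only [← Finset.sum_sub_distrib]
      simp only [Finset.sum_mul, Finset.mul_sum]
      simp only [← Fintype.sum_prod_type']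
      refine Fintype.sum_equiv
        (⟨fun q => (q.2.2.1, q.2.2.2.1, q.2.2.2.2.1, q.2.2.2.2.2, q.1, q.2.1),
          fun q => (q.2.2.2.2.1, q.2.2.2.2.2, q.1, q.2.1, q.2.2.1, q.2.2.2.1),
          fun _ => rfl, fun _ => rfl⟩ :
          (Fin n × Fin n × Fin n × Fin n × Fin n × Fin n) ≃
            (Fin n × Fin n × Fin n × Fin n × Fin n × Fin n)) _ _ ?_
      rintro ⟨m, p, l, k, i, j⟩
      simp only [Equiv.coe_fn_mk]
      ring
    rw [e3]
    simp only [← Finset.sum_sub_distrib, ← Finset.sum_add_distrib]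
    refine Finset.sum_congr rfl fun l _ => Finset.sum_congr rfl fun k _ =>
      Finset.sum_congr rfl fun i _ => Finset.sum_congr rfl fun j _ => ?_
    rw [hG.riemannLow_eq hx]
    ring
  rw [h1, hG.contraction_eq_of_frames hx horth hA hC hspan]
  simp only [sub_mul, Finset.sum_sub_distrib, sum_christoffelLow_mul_eq]
  ring

end Directional

/-! ### Frame bookkeeping and functions with a double zero -/

section

variable {n : ℕ} {U : Set (EuclideanSpace ℝ (Fin n))}
  {G : EuclideanSpace ℝ (Fin n) → Matrix (Fin n) (Fin n) ℝ} {x : EuclideanSpace ℝ (Fin n)}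

theorem coordInner_sub_left (u u' v : EuclideanSpace ℝ (Fin n)) :
    coordInner G x (u - u') v = coordInner G x u v - coordInner G x u' v := by
  simp only [coordInner, PiLp.sub_apply, mul_sub, sub_mul, Finset.sum_sub_distrib]

theorem coordInner_sub_right (u v v' : EuclideanSpace ℝ (Fin n)) :
    coordInner G x u (v - v') = coordInner G x u v - coordInner G x u v' := by
  simp only [coordInner, PiLp.sub_apply, mul_sub, Finset.sum_sub_distrib]

theorem directionalDeriv_single (i : Fin n) (F : EuclideanSpace ℝ (Fin n) → ℝ) :
    directionalDeriv (EuclideanSpace.single i 1) F x = partialDeriv i F x := by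
  simp [directionalDeriv]

theorem directionalDeriv_congr {F H : EuclideanSpace ℝ (Fin n) → ℝ} (hU : IsOpen U)
    (h : ∀ y ∈ U, F y = H y) (hx : x ∈ U) (v : EuclideanSpace ℝ (Fin n)) :
    directionalDeriv v F x = directionalDeriv v H x := by
  simp only [directionalDeriv, partialDeriv_congr hU h hx]

theorem partialDeriv_mul_mul_of_eq_zero {F P Q : EuclideanSpace ℝ (Fin n) → ℝ} (hU : IsOpen U)
    (hF : ContDiffOn ℝ ∞ F U) (hP : ContDiffOn ℝ ∞ P U) (hQ : ContDiffOn ℝ ∞ Q U)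
    (hx : x ∈ U) (hP0 : P x = 0) (hQ0 : Q x = 0) (i : Fin n) :
    partialDeriv i (fun y => F y * (P y * Q y)) x = 0 := by
  have dF := hF.differentiableAt_of_isOpen hU hx
  have dP := hP.differentiableAt_of_isOpen hU hx
  have dQ := hQ.differentiableAt_of_isOpen hU hx
  rw [partialDeriv_mul dF (dP.fun_mul dQ), partialDeriv_mul dP dQ, hP0, hQ0]
  ring

/-- At a common zero of P and Q, a term of the Leibniz expansion survives only if each of the two
factors is differentiated exactly once. -/
theorem partialDeriv_partialDeriv_mul_mul_of_eq_zero {F P Q : EuclideanSpace ℝ (Fin n) → ℝ}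
    (hU : IsOpen U) (hF : ContDiffOn ℝ ∞ F U) (hP : ContDiffOn ℝ ∞ P U)
    (hQ : ContDiffOn ℝ ∞ Q U) (hx : x ∈ U) (hP0 : P x = 0) (hQ0 : Q x = 0) (i j : Fin n) :
    partialDeriv i (partialDeriv j (fun y => F y * (P y * Q y))) x
      = F x * (partialDeriv i P x * partialDeriv j Q x
        + partialDeriv j P x * partialDeriv i Q x) := by
  have h : ∀ y ∈ U, partialDeriv j (fun y => F y * (P y * Q y)) y
      = partialDeriv j F y * (P y * Q y)
        + F y * (partialDeriv j P y * Q y + P y * partialDeriv j Q y) := by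
    intro y hy
    have dF := hF.differentiableAt_of_isOpen hU hy
    have dP := hP.differentiableAt_of_isOpen hU hy
    have dQ := hQ.differentiableAt_of_isOpen hU hy
    rw [partialDeriv_mul dF (dP.fun_mul dQ), partialDeriv_mul dP dQ]
  have dF := hF.differentiableAt_of_isOpen hU hx
  have dP := hP.differentiableAt_of_isOpen hU hx
  have dQ := hQ.differentiableAt_of_isOpen hU hx
  have dF' := (contDiffOn_partialDeriv hU hF j).differentiableAt_of_isOpen hU hx
  have dP' := (contDiffOn_partialDeriv hU hP j).differentiableAt_of_isOpen hU hx
  have dQ' := (contDiffOn_partialDeriv hU hQ j).differentiableAt_of_isOpen hU hx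
  rw [partialDeriv_congr hU h hx, partialDeriv_add (dF'.fun_mul (dP.fun_mul dQ))
    (dF.fun_mul ((dP'.fun_mul dQ).fun_add (dP.fun_mul dQ'))), partialDeriv_mul dF' (dP.fun_mul dQ),
    partialDeriv_mul dP dQ, partialDeriv_mul dF ((dP'.fun_mul dQ).fun_add (dP.fun_mul dQ')),
    partialDeriv_add (dP'.fun_mul dQ) (dP.fun_mul dQ'), partialDeriv_mul dP' dQ, partialDeriv_mul dP dQ',
    hP0, hQ0]
  ring

end

/-- In dimension two, the scalar curvature is twice the Gaussian curvature. -/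
theorem IsCoordMetric.scalarCurvature_eq {U : Set E2} {G : E2 → Matrix (Fin 2) (Fin 2) ℝ} {x : E2}
    (hG : IsCoordMetric U G) (hx : x ∈ U) :
    scalarCurvature G x = 2 * riemannLow G 0 1 0 1 x / (G x).det := by
  have hd := hG.det_ne_zero x hx
  have hs := hG.symm x hx 1 0
  have hzr : ∀ l k i, riemannLow G l k i i x = 0 := fun l k i => by
    linarith [IsCoordMetric.riemannLow_antisymm_right (G := G) (x := x) l k i i]
  have hzl : ∀ l i j, riemannLow G l l i j x = 0 := fun l i j => by
    linarith [hG.riemannLow_antisymm_left hx l l i j]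
  have hr : ∀ l k, riemannLow G l k 1 0 x = -riemannLow G l k 0 1 x := fun l k =>
    IsCoordMetric.riemannLow_antisymm_right l k 1 0
  have hl : ∀ i j, riemannLow G 1 0 i j x = -riemannLow G 0 1 i j x := fun i j =>
    hG.riemannLow_antisymm_left hx 1 0 i j
  simp only [scalarCurvature, hG.ricci_eq hx, Fin.sum_univ_two, Matrix.inv_def, hzr, hzl, hr, hl,
    Matrix.smul_apply, Ring.inverse_eq_inv', smul_eq_mul, Matrix.adjugate_fin_two,
    Matrix.of_apply, Matrix.cons_val', Matrix.cons_val_zero, Matrix.cons_val_one,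
    Matrix.cons_val_fin_one]
  have he : (G x).det = G x 0 0 * G x 1 1 - G x 0 1 ^ 2 := by
    rw [Matrix.det_fin_two, hs, sq]
  rw [hs]
  rw [he] at hd ⊢
  field_simp
  ring

/-! ### Metrics in adapted coordinates -/

open Adapted

/-- `G` is the matrix of components of a smooth metric on `U` in adapted coordinates. -/
structure IsAdaptedCoordMetric (U : Set E4) (G : E4 → Matrix (Fin (2 + 2)) (Fin (2 + 2)) ℝ) : Prop
    extends IsCoordMetric U G where
  det_h_ne_zero : ∀ x ∈ U, (h G x).det ≠ 0
  invariant : ∀ k : Fin 2, ∀ a b, ∀ x ∈ U, partialDeriv (Fin.natAdd 2 k) (fun y => G y a b) x = 0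

/-- The constant vector field with the value `e_i = ∂/∂tⁱ - f_i^k ∂/∂zᵏ` at `x`. -/
def horizontalVector (G : E4 → Matrix (Fin (2 + 2)) (Fin (2 + 2)) ℝ) (x : E4) (i : Fin 2) : E4 :=
  EuclideanSpace.single (Fin.castAdd 2 i) 1
    - ∑ k, fUp G x i k • EuclideanSpace.single (Fin.natAdd 2 k) (1 : ℝ)

/-- The constant vector field `∂/∂zᵏ`. -/
def verticalVector (k : Fin 2) : E4 := EuclideanSpace.single (Fin.natAdd 2 k) 1

/-- The function `h_kl (f_i^k - f_i^k(x)) (f_j^l - f_j^l(x))`. -/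
def orbitError (G : E4 → Matrix (Fin (2 + 2)) (Fin (2 + 2)) ℝ) (x : E4) (i j : Fin 2) (y : E4) :
    ℝ :=
  ∑ k, ∑ l, h G y k l * ((fUp G y i k - fUp G x i k) * (fUp G y j l - fUp G x j l))

/-- The expression `½ (∂ᵢ gₘⱼ + ∂ⱼ gₘᵢ - ∂ₘ gᵢⱼ)` in the variables `t`. -/
def orbitChristoffel (g : Fin 2 → Fin 2 → E4 → ℝ) (m i j : Fin 2) (y : E4) : ℝ :=
  (1 / 2) * (partialDeriv (Fin.castAdd 2 i) (g m j) y + partialDeriv (Fin.castAdd 2 j) (g m i) y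
    - partialDeriv (Fin.castAdd 2 m) (g i j) y)

theorem contDiffOn_orbitChristoffel {U : Set E4} {g : Fin 2 → Fin 2 → E4 → ℝ} (hU : IsOpen U)
    (hg : ∀ i j, ContDiffOn ℝ ∞ (g i j) U) (m i j : Fin 2) :
    ContDiffOn ℝ ∞ (orbitChristoffel g m i j) U :=
  contDiffOn_const.mul (((contDiffOn_partialDeriv hU (hg _ _) _).add
    (contDiffOn_partialDeriv hU (hg _ _) _)).sub (contDiffOn_partialDeriv hU (hg _ _) _))

theorem partialDeriv_orbitChristoffel {U : Set E4} {g : Fin 2 → Fin 2 → E4 → ℝ} (hU : IsOpen U)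
    (hg : ∀ i j, ContDiffOn ℝ ∞ (g i j) U) {x : E4} (hx : x ∈ U) (m i j : Fin 2)
    (c : Fin (2 + 2)) :
    partialDeriv c (orbitChristoffel g m i j) x
      = (1 / 2) * (partialDeriv c (partialDeriv (Fin.castAdd 2 i) (g m j)) x
        + partialDeriv c (partialDeriv (Fin.castAdd 2 j) (g m i)) x
        - partialDeriv c (partialDeriv (Fin.castAdd 2 m) (g i j)) x) := by
  have hd : ∀ a i j, DifferentiableAt ℝ (partialDeriv (Fin.castAdd 2 a) (g i j)) x := fun a i j =>
    (contDiffOn_partialDeriv hU (hg i j) _).differentiableAt_of_isOpen hU hx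
  show partialDeriv c (fun y => (1 / 2) * (partialDeriv (Fin.castAdd 2 i) (g m j) y
    + partialDeriv (Fin.castAdd 2 j) (g m i) y - partialDeriv (Fin.castAdd 2 m) (g i j) y)) x = _
  rw [partialDeriv_const_mul (((hd _ _ _).fun_add (hd _ _ _)).fun_sub (hd _ _ _)),
    partialDeriv_sub ((hd _ _ _).fun_add (hd _ _ _)) (hd _ _ _),
    partialDeriv_add (hd _ _ _) (hd _ _ _)]

theorem partialDeriv_partialDeriv_eq_zero {U : Set E4} {F : E4 → ℝ} (hU : IsOpen U)
    (hF : ContDiffOn ℝ ∞ F U) {c : Fin (2 + 2)} (h0 : ∀ y ∈ U, partialDeriv c F y = 0) {x : E4}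
    (hx : x ∈ U) (a : Fin (2 + 2)) : partialDeriv c (partialDeriv a F) x = 0 := by
  rw [partialDeriv_comm hU hF hx, partialDeriv_congr hU h0 hx]
  simp [partialDeriv]

theorem directionalDeriv_verticalVector (k : Fin 2) (F : E4 → ℝ) (x : E4) :
    directionalDeriv (verticalVector k) F x = partialDeriv (Fin.natAdd 2 k) F x :=
  directionalDeriv_single _ _

theorem directionalDeriv_horizontalVector {G : E4 → Matrix (Fin (2 + 2)) (Fin (2 + 2)) ℝ}
    {F : E4 → ℝ} {y : E4} (h0 : ∀ k : Fin 2, partialDeriv (Fin.natAdd 2 k) F y = 0) (x : E4)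
    (i : Fin 2) :
    directionalDeriv (horizontalVector G x i) F y = partialDeriv (Fin.castAdd 2 i) F y := by
  have h1 : ∀ j : Fin 2, horizontalVector G x i (Fin.castAdd 2 j) = if j = i then 1 else 0 := by
    intro j
    fin_cases i <;> fin_cases j <;> simp [horizontalVector, Fin.ext_iff]
  rw [directionalDeriv, Fin.sum_univ_add]
  simp only [h0, h1, ite_mul, one_mul, zero_mul, mul_zero, Finset.sum_const_zero, add_zero,
    Finset.sum_ite_eq', Finset.mem_univ, if_true]

namespace IsAdaptedCoordMetric

variable {U : Set E4} {G : E4 → Matrix (Fin (2 + 2)) (Fin (2 + 2)) ℝ} {x y : E4}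

theorem contDiffOn_h (k l : Fin 2) (hG : IsAdaptedCoordMetric U G) :
    ContDiffOn ℝ ∞ (fun y => h G y k l) U :=
  hG.smooth _ _

theorem contDiffOn_fUp (hG : IsAdaptedCoordMetric U G) (i k : Fin 2) :
    ContDiffOn ℝ ∞ (fun y => fUp G y i k) U := by
  simp only [fUp, Matrix.mul_apply]
  exact ContDiffOn.sum fun l _ => (hG.smooth _ _).mul
    (contDiffOn_matrix_inv (fun a b => hG.smooth _ _) hG.det_h_ne_zero l k)

theorem contDiffOn_orbit (hG : IsAdaptedCoordMetric U G) (i j : Fin 2) :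
    ContDiffOn ℝ ∞ (fun y => orbit G y i j) U := by
  have : (fun y => orbit G y i j)
      = fun y => b G y i j - ∑ l, fUp G y i l * f G y j l := by
    funext y
    simp [orbit, fUp, Matrix.mul_apply]
  rw [this]
  exact (hG.smooth _ _).sub (ContDiffOn.sum fun l _ => (hG.contDiffOn_fUp i l).mul (hG.smooth _ _))

theorem h_symm (hG : IsAdaptedCoordMetric U G) (hx : x ∈ U) : (h G x).transpose = h G x :=
  Matrix.ext fun _ _ => hG.symm x hx _ _

theorem f_eq (hG : IsAdaptedCoordMetric U G) (hx : x ∈ U) : f G x = fUp G x * h G x := by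
  rw [fUp, Matrix.mul_assoc, Matrix.nonsing_inv_mul _
    (isUnit_iff_ne_zero.2 (hG.det_h_ne_zero x hx)), Matrix.mul_one]

theorem b_eq (hG : IsAdaptedCoordMetric U G) (hx : x ∈ U) :
    b G x = orbit G x + fUp G x * h G x * (fUp G x).transpose := by
  have h1 : (fUp G x).transpose = (h G x)⁻¹ * (f G x).transpose := by
    rw [fUp, Matrix.transpose_mul, Matrix.transpose_nonsing_inv, hG.h_symm hx]
  rw [← hG.f_eq hx, h1, orbit, Matrix.mul_assoc]
  abel

theorem orbit_symm (hG : IsAdaptedCoordMetric U G) (hx : x ∈ U) :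
    (orbit G x).transpose = orbit G x := by
  have hb : (b G x).transpose = b G x := Matrix.ext fun _ _ => hG.symm x hx _ _
  rw [orbit, Matrix.transpose_sub, hb, Matrix.transpose_mul, Matrix.transpose_mul,
    Matrix.transpose_nonsing_inv, hG.h_symm hx, Matrix.transpose_transpose, Matrix.mul_assoc]

/-- The orbit metric is the Schur complement of h in G, so det G = det h · det g̃. -/
theorem det_orbit_ne_zero (hG : IsAdaptedCoordMetric U G) (hx : x ∈ U) :
    (orbit G x).det ≠ 0 := by
  have : Invertible (h G x) :=
    Matrix.invertibleOfIsUnitDet _ (isUnit_iff_ne_zero.2 (hG.det_h_ne_zero x hx))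
  have h1 : (G x).submatrix finSumFinEquiv finSumFinEquiv
      = Matrix.fromBlocks (b G x) (f G x) (f G x).transpose (h G x) := by
    ext i j
    rcases i with i | i <;> rcases j with j | j
    · rfl
    · rfl
    · exact hG.symm x hx _ _
    · rfl
  have h2 : (G x).det = (h G x).det * (orbit G x).det := by
    rw [← Matrix.det_submatrix_equiv_self finSumFinEquiv (G x), h1, Matrix.det_fromBlocks₂₂,
      Matrix.invOf_eq_nonsing_inv, orbit]
  exact right_ne_zero_of_mul (h2 ▸ hG.det_ne_zero x hx)

theorem coordInner_vertical_vertical (k l : Fin 2) :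
    coordInner G y (verticalVector k) (verticalVector l) = h G y k l :=
  coordInner_single_single _ _

/-- The frozen field is orthogonal to the orbit through its base point `x`. At other points it
misses orthogonality by the variation of f, whose first derivatives enter the curvature. -/
theorem coordInner_vertical_horizontal (hG : IsAdaptedCoordMetric U G) (hy : y ∈ U) (x : E4)
    (k i : Fin 2) :
    coordInner G y (verticalVector k) (horizontalVector G x i)
      = ∑ l, h G y k l * (fUp G y i l - fUp G x i l) := by
  have hf : G y (Fin.natAdd 2 k) (Fin.castAdd 2 i) = ∑ l, fUp G y i l * h G y l k := by
    rw [← Matrix.mul_apply, ← hG.f_eq hy, hG.symm y hy]; rfl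
  have hs : ∀ l, h G y l k = h G y k l := fun l => hG.symm y hy _ _
  simp only [verticalVector, horizontalVector, Fin.sum_univ_two, coordInner_sub_right,
    coordInner_add_right, coordInner_smul_right, coordInner_single_single, hf, hs]
  simp only [h, Matrix.submatrix_apply]
  ring

/-- The frozen field differs from the true horizontal lift at `y` by a vertical vector. The products
of these vertical differences form `orbitError`, which has a double zero at `x`. -/
theorem coordInner_horizontal_horizontal (hG : IsAdaptedCoordMetric U G) (hy : y ∈ U) (x : E4)
    (i j : Fin 2) :
    coordInner G y (horizontalVector G x i) (horizontalVector G x j)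
      = orbit G y i j + orbitError G x i j y := by
  have hf : ∀ i k, G y (Fin.castAdd 2 i) (Fin.natAdd 2 k) = ∑ l, fUp G y i l * h G y l k := by
    intro i k
    rw [← Matrix.mul_apply, ← hG.f_eq hy]; rfl
  have hf' : ∀ i k, G y (Fin.natAdd 2 k) (Fin.castAdd 2 i) = ∑ l, fUp G y i l * h G y l k := by
    intro i k
    rw [← hf, hG.symm y hy]
  have hb : G y (Fin.castAdd 2 i) (Fin.castAdd 2 j)
      = orbit G y i j + ∑ l, (∑ k, fUp G y i k * h G y k l) * fUp G y j l := by
    have := congrFun (congrFun (hG.b_eq hy) i) j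
    show b G y i j = _
    simpa [Matrix.mul_apply] using this
  have hh : ∀ k l, G y (Fin.natAdd 2 k) (Fin.natAdd 2 l) = h G y k l := fun _ _ => rfl
  have hs : h G y 1 0 = h G y 0 1 := hG.symm y hy _ _
  simp only [horizontalVector, orbitError, Fin.sum_univ_two, coordInner_sub_right,
    coordInner_add_right, coordInner_smul_right, coordInner_sub_left, coordInner_add_left,
    coordInner_smul_left, coordInner_single_single, hf, hf', hb, hh, hs]
  ring

theorem top_le_span (G : E4 → Matrix (Fin (2 + 2)) (Fin (2 + 2)) ℝ) (x : E4) :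
    ⊤ ≤ Submodule.span ℝ (Set.range (horizontalVector G x) ∪ Set.range verticalVector) := by
  have hv : ∀ k, verticalVector k ∈
      Submodule.span ℝ (Set.range (horizontalVector G x) ∪ Set.range verticalVector) := fun k =>
    Submodule.subset_span (Or.inr ⟨k, rfl⟩)
  have hb := (EuclideanSpace.basisFun (Fin (2 + 2)) ℝ).toBasis.span_eq
  rw [← hb, Submodule.span_le]
  rintro _ ⟨a, rfl⟩
  simp only [OrthonormalBasis.coe_toBasis, EuclideanSpace.basisFun_apply, SetLike.mem_coe]
  refine Fin.addCases (fun i => ?_) (fun k => hv k) a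
  have : EuclideanSpace.single (Fin.castAdd 2 i) (1 : ℝ) = horizontalVector G x i
      + ∑ k, fUp G x i k • verticalVector k := by
    simp [horizontalVector, verticalVector]
  rw [this]
  exact Submodule.add_mem _ (Submodule.subset_span (Or.inl ⟨i, rfl⟩))
    (Submodule.sum_mem _ fun k _ => Submodule.smul_mem _ _ (hv k))

theorem contDiffOn_orbitError (hG : IsAdaptedCoordMetric U G) (x : E4) (i j : Fin 2) :
    ContDiffOn ℝ ∞ (orbitError G x i j) U :=
  ContDiffOn.sum fun k _ => ContDiffOn.sum fun l _ => (hG.contDiffOn_h k l).mul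
    (((hG.contDiffOn_fUp i k).sub contDiffOn_const).mul
      ((hG.contDiffOn_fUp j l).sub contDiffOn_const))

end IsAdaptedCoordMetric

/-! ### Christoffel symbols on horizontal and vertical fields; the curvatures of the two planes -/

namespace IsAdaptedCoordMetric

variable {U : Set E4} {G : E4 → Matrix (Fin (2 + 2)) (Fin (2 + 2)) ℝ} {x y : E4}

theorem partialDeriv_natAdd_coordInner (hG : IsAdaptedCoordMetric U G) (hy : y ∈ U) (u v : E4)
    (k : Fin 2) : partialDeriv (Fin.natAdd 2 k) (fun y => coordInner G y u v) y = 0 := by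
  simp only [hG.partialDeriv_coordInner hy, hG.invariant k _ _ y hy, zero_mul,
    Finset.sum_const_zero]

theorem partialDeriv_natAdd_orbitChristoffel {g : Fin 2 → Fin 2 → E4 → ℝ} (hU : IsOpen U)
    (hg : ∀ i j, ContDiffOn ℝ ∞ (g i j) U) {c : Fin (2 + 2)}
    (h0 : ∀ i j, ∀ y ∈ U, partialDeriv c (g i j) y = 0) (hy : y ∈ U) (m i j : Fin 2) :
    partialDeriv c (orbitChristoffel g m i j) y = 0 := by
  rw [partialDeriv_orbitChristoffel hU hg hy,
    partialDeriv_partialDeriv_eq_zero hU (hg _ _) (h0 _ _) hy,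
    partialDeriv_partialDeriv_eq_zero hU (hg _ _) (h0 _ _) hy,
    partialDeriv_partialDeriv_eq_zero hU (hg _ _) (h0 _ _) hy]
  ring

/-- Needed at all `y` near the base point, because this symbol is differentiated in the curvature.
The symbol in `christoffelForm_vhh` enters only through products, so its value at `x` suffices
there. -/
theorem christoffelForm_hhh (hG : IsAdaptedCoordMetric U G) (hy : y ∈ U) (x : E4)
    (m i j : Fin 2) :
    christoffelForm G (horizontalVector G x m) (horizontalVector G x i) (horizontalVector G x j) y
      = orbitChristoffel
        (fun i j y => coordInner G y (horizontalVector G x i) (horizontalVector G x j)) m i j y := by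
  rw [hG.christoffelForm_eq hy, orbitChristoffel]
  simp only [directionalDeriv_horizontalVector (fun k =>
    hG.partialDeriv_natAdd_coordInner hy _ _ k)]

theorem christoffelForm_hvv (hG : IsAdaptedCoordMetric U G) (hy : y ∈ U) (x : E4)
    (i k l : Fin 2) :
    christoffelForm G (horizontalVector G x i) (verticalVector k) (verticalVector l) y
      = -(1 / 2) * partialDeriv (Fin.castAdd 2 i) (fun y => h G y k l) y := by
  rw [hG.christoffelForm_eq hy,
    directionalDeriv_horizontalVector (fun k => hG.partialDeriv_natAdd_coordInner hy _ _ k)]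
  simp only [directionalDeriv_verticalVector, hG.partialDeriv_natAdd_coordInner hy,
    coordInner_vertical_vertical]
  ring

/-- The metric induced on an orbit has constant coefficients h_kl along it, so the orbits are
intrinsically flat. -/
theorem christoffelForm_vvv (hG : IsAdaptedCoordMetric U G) (hy : y ∈ U) (k l m : Fin 2) :
    christoffelForm G (verticalVector k) (verticalVector l) (verticalVector m) y = 0 := by
  rw [hG.christoffelForm_eq hy]
  simp only [directionalDeriv_verticalVector, hG.partialDeriv_natAdd_coordInner hy]
  ring

theorem christoffelForm_vhh (hG : IsAdaptedCoordMetric U G) (hx : x ∈ U) (k i j : Fin 2) :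
    christoffelForm G (verticalVector k) (horizontalVector G x i) (horizontalVector G x j) x
      = ∑ l, h G x k l * ((1 / 2) * (partialDeriv (Fin.castAdd 2 i) (fun y => fUp G y j l) x
        + partialDeriv (Fin.castAdd 2 j) (fun y => fUp G y i l) x)) := by
  have key : ∀ i j : Fin 2, partialDeriv (Fin.castAdd 2 i)
      (fun y => coordInner G y (verticalVector k) (horizontalVector G x j)) x
      = ∑ l, h G x k l * partialDeriv (Fin.castAdd 2 i) (fun y => fUp G y j l) x := by
    intro i j
    have dh : ∀ l, DifferentiableAt ℝ (fun y => h G y k l) x := fun l =>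
      (hG.contDiffOn_h k l).differentiableAt_of_isOpen hG.isOpen hx
    have df : ∀ l, DifferentiableAt ℝ (fun y => fUp G y j l) x := fun l =>
      (hG.contDiffOn_fUp j l).differentiableAt_of_isOpen hG.isOpen hx
    rw [partialDeriv_congr hG.isOpen
      (fun y hy => hG.coordInner_vertical_horizontal hy x k j) hx,
      partialDeriv_sum fun l _ => (dh l).fun_mul ((df l).sub_const _)]
    refine Finset.sum_congr rfl fun l _ => ?_
    rw [partialDeriv_mul (dh l) ((df l).sub_const _),
      partialDeriv_sub (df l) (differentiableAt_const _)]
    simp [partialDeriv]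
  rw [hG.christoffelForm_eq hx]
  simp only [directionalDeriv_verticalVector, hG.partialDeriv_natAdd_coordInner hx,
    directionalDeriv_horizontalVector (fun k => hG.partialDeriv_natAdd_coordInner hx _ _ k), key,
    Fin.sum_univ_two]
  ring

theorem partialDeriv_horizontal (hG : IsAdaptedCoordMetric U G) (hx : x ∈ U) (i j : Fin 2)
    (a : Fin (2 + 2)) :
    partialDeriv a (fun y => coordInner G y (horizontalVector G x i) (horizontalVector G x j)) x
      = partialDeriv a (fun y => orbit G y i j) x := by
  have hs : ∀ i k, ContDiffOn ℝ ∞ (fun y => fUp G y i k - fUp G x i k) U := fun i k =>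
    (hG.contDiffOn_fUp i k).sub contDiffOn_const
  rw [partialDeriv_congr hG.isOpen (fun y hy => hG.coordInner_horizontal_horizontal hy x i j) hx,
    partialDeriv_add ((hG.contDiffOn_orbit i j).differentiableAt_of_isOpen hG.isOpen hx)
    ((hG.contDiffOn_orbitError x i j).differentiableAt_of_isOpen hG.isOpen hx), add_eq_left]
  have hd : ∀ k l, DifferentiableAt ℝ (fun y =>
      h G y k l * ((fUp G y i k - fUp G x i k) * (fUp G y j l - fUp G x j l))) x := fun k l =>
    ((hG.contDiffOn_h k l).mul ((hs i k).mul (hs j l))).differentiableAt_of_isOpen hG.isOpen hx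
  show partialDeriv a (fun y => orbitError G x i j y) x = 0
  simp only [orbitError]
  rw [partialDeriv_sum fun k _ => DifferentiableAt.fun_sum fun l _ => hd k l]
  refine Finset.sum_eq_zero fun k _ => ?_
  rw [partialDeriv_sum fun l _ => hd k l]
  exact Finset.sum_eq_zero fun l _ => partialDeriv_mul_mul_of_eq_zero hG.isOpen
    (hG.contDiffOn_h k l) (hs i k) (hs j l) hx (sub_self _) (sub_self _) a

/-- The error term is invisible to first derivatives at `x` but not to second ones. The extra sum
here is one of the two sources of the O'Neill term. -/
theorem partialDeriv_partialDeriv_horizontal (hG : IsAdaptedCoordMetric U G) (hx : x ∈ U)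
    (i j : Fin 2) (a c : Fin (2 + 2)) :
    partialDeriv a (partialDeriv c
      (fun y => coordInner G y (horizontalVector G x i) (horizontalVector G x j))) x
      = partialDeriv a (partialDeriv c (fun y => orbit G y i j)) x
        + ∑ k, ∑ l, h G x k l *
          (partialDeriv a (fun y => fUp G y i k) x * partialDeriv c (fun y => fUp G y j l) x
          + partialDeriv c (fun y => fUp G y i k) x * partialDeriv a (fun y => fUp G y j l) x) := by
  have hs : ∀ i k, ContDiffOn ℝ ∞ (fun y => fUp G y i k - fUp G x i k) U := fun i k =>
    (hG.contDiffOn_fUp i k).sub contDiffOn_const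
  have hds : ∀ (i k : Fin 2) (a : Fin (2 + 2)),
      partialDeriv a (fun y => fUp G y i k - fUp G x i k) x
      = partialDeriv a (fun y => fUp G y i k) x := by
    intro i k a
    rw [partialDeriv_sub ((hG.contDiffOn_fUp i k).differentiableAt_of_isOpen hG.isOpen hx)
      (differentiableAt_const _)]
    simp [partialDeriv]
  have hsm : ∀ k l, ContDiffOn ℝ ∞ (fun y =>
      h G y k l * ((fUp G y i k - fUp G x i k) * (fUp G y j l - fUp G x j l))) U := fun k l =>
    (hG.contDiffOn_h k l).mul ((hs i k).mul (hs j l))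
  have h1 : ∀ y ∈ U, partialDeriv c
      (fun y => coordInner G y (horizontalVector G x i) (horizontalVector G x j)) y
      = partialDeriv c (fun y => orbit G y i j) y + ∑ k, ∑ l, partialDeriv c (fun y =>
        h G y k l * ((fUp G y i k - fUp G x i k) * (fUp G y j l - fUp G x j l))) y := by
    intro y hy
    have hd := fun k l => (hsm k l).differentiableAt_of_isOpen hG.isOpen hy
    rw [partialDeriv_congr hG.isOpen (fun y hy => hG.coordInner_horizontal_horizontal hy x i j) hy,
      partialDeriv_add ((hG.contDiffOn_orbit i j).differentiableAt_of_isOpen hG.isOpen hy)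
      ((hG.contDiffOn_orbitError x i j).differentiableAt_of_isOpen hG.isOpen hy), add_right_inj]
    show partialDeriv c (fun y => orbitError G x i j y) y = _
    simp only [orbitError]
    rw [partialDeriv_sum fun k _ => DifferentiableAt.fun_sum fun l _ => hd k l]
    exact Finset.sum_congr rfl fun k _ => partialDeriv_sum (fun l _ => hd k l) c
  have hd := fun k l =>
    (contDiffOn_partialDeriv hG.isOpen (hsm k l) c).differentiableAt_of_isOpen hG.isOpen hx
  rw [partialDeriv_congr hG.isOpen h1 hx, partialDeriv_add
    ((contDiffOn_partialDeriv hG.isOpen (hG.contDiffOn_orbit i j) c).differentiableAt_of_isOpen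
      hG.isOpen hx) (DifferentiableAt.fun_sum fun k _ => DifferentiableAt.fun_sum fun l _ => hd k l),
    partialDeriv_sum fun k _ => DifferentiableAt.fun_sum fun l _ => hd k l, add_right_inj]
  refine Finset.sum_congr rfl fun k _ => ?_
  rw [partialDeriv_sum fun l _ => hd k l]
  refine Finset.sum_congr rfl fun l _ => ?_
  rw [partialDeriv_partialDeriv_mul_mul_of_eq_zero hG.isOpen (hG.contDiffOn_h k l) (hs i k)
    (hs j l) hx (sub_self _) (sub_self _)]
  simp only [hds]

theorem coordInner_horizontal_self (hG : IsAdaptedCoordMetric U G) (hx : x ∈ U) (i j : Fin 2) :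
    coordInner G x (horizontalVector G x i) (horizontalVector G x j) = orbit G x i j := by
  simp [hG.coordInner_horizontal_horizontal hx, orbitError]

theorem coordInner_horizontal_vertical_self (hG : IsAdaptedCoordMetric U G) (hx : x ∈ U)
    (i k : Fin 2) : coordInner G x (horizontalVector G x i) (verticalVector k) = 0 := by
  rw [hG.coordInner_symm hx, hG.coordInner_vertical_horizontal hx]
  simp

theorem riemannForm_adapted (hG : IsAdaptedCoordMetric U G) (hx : x ∈ U) (d c a b : E4) :
    riemannForm G x d c a b
      = directionalDeriv a (christoffelForm G d b c) x
        - directionalDeriv b (christoffelForm G d a c) x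
        + ∑ p, ∑ q, (orbit G x)⁻¹ p q *
          (christoffelForm G (horizontalVector G x p) b d x
              * christoffelForm G (horizontalVector G x q) a c x
            - christoffelForm G (horizontalVector G x p) a d x
              * christoffelForm G (horizontalVector G x q) b c x)
        + ∑ p, ∑ q, (h G x)⁻¹ p q *
          (christoffelForm G (verticalVector p) b d x * christoffelForm G (verticalVector q) a c x
            - christoffelForm G (verticalVector p) a d x
              * christoffelForm G (verticalVector q) b c x) := by
  refine hG.riemannForm_eq_of_frames hx (hG.coordInner_horizontal_vertical_self hx) ?_ ?_
    (top_le_span G x) d c a b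
  · simp only [hG.coordInner_horizontal_self hx]
    exact Matrix.nonsing_inv_mul _ (isUnit_iff_ne_zero.2 (hG.det_orbit_ne_zero hx))
  · simp only [coordInner_vertical_vertical]
    exact Matrix.nonsing_inv_mul _ (isUnit_iff_ne_zero.2 (hG.det_h_ne_zero x hx))

/-- The Gauss equation for the orbits. -/
theorem coordSectional_vertical (hG : IsAdaptedCoordMetric U G) (hx : x ∈ U) :
    coordSectional G x (verticalVector 0) (verticalVector 1) = -(1 / 4) * Cchi G x := by
  have hd0 : ∀ k l m n : Fin 2, directionalDeriv (verticalVector n)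
      (christoffelForm G (verticalVector k) (verticalVector l) (verticalVector m)) x = 0 := by
    intro k l m n
    rw [directionalDeriv_congr hG.isOpen (fun y hy => hG.christoffelForm_vvv hy k l m) hx]
    simp [directionalDeriv, partialDeriv]
  have hR := hG.riemannForm_adapted hx (verticalVector 0) (verticalVector 1) (verticalVector 0)
    (verticalVector 1)
  have hs : ∀ i : Fin 2, partialDeriv (Fin.castAdd 2 i) (fun y => h G y 1 0) x
      = partialDeriv (Fin.castAdd 2 i) (fun y => h G y 0 1) x := fun i =>
    partialDeriv_congr hG.isOpen (fun y hy => hG.symm y hy _ _) hx _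
  have hinv : (orbit G x)⁻¹ 1 0 = (orbit G x)⁻¹ 0 1 := by
    have := congrFun (congrFun (Matrix.transpose_nonsing_inv (orbit G x)) 0) 1
    rwa [hG.orbit_symm hx] at this
  have hdet : (h G x).det = h G x 0 0 * h G x 1 1 - h G x 0 1 ^ 2 := by
    rw [Matrix.det_fin_two, show h G x 1 0 = h G x 0 1 from hG.symm x hx _ _, sq]
  have hne := hG.det_h_ne_zero x hx
  show riemannForm G x (verticalVector 0) (verticalVector 1) (verticalVector 0)
    (verticalVector 1) / _ = _
  rw [hR]
  -- Only products of normal components -½ ∂_i h_kl remain: ¼ g̃^pq (∂_p h₁₂ ∂_q h₁₂ - ∂_p h₁₁ ∂_q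
  -- h₂₂), which is -¼ C_χ det h.
  simp only [hd0, hG.christoffelForm_vvv hx, hG.christoffelForm_hvv hx,
    coordInner_vertical_vertical, ← hdet, Cchi, chi, Matrix.of_apply, Fin.sum_univ_two, hs, hinv]
  field_simp
  ring

/-- O'Neill's formula for the sectional curvature of the horizontal plane. -/
theorem riemannForm_horizontal (hG : IsAdaptedCoordMetric U G) (hx : x ∈ U) :
    riemannForm G x (horizontalVector G x 0) (horizontalVector G x 1) (horizontalVector G x 0)
        (horizontalVector G x 1)
      = partialDeriv (Fin.castAdd 2 0) (orbitChristoffel (fun i j y => orbit G y i j) 0 1 1) x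
        - partialDeriv (Fin.castAdd 2 1) (orbitChristoffel (fun i j y => orbit G y i j) 0 0 1) x
        + ∑ p, ∑ q, (orbit G x)⁻¹ p q *
          (orbitChristoffel (fun i j y => orbit G y i j) p 1 0 x
              * orbitChristoffel (fun i j y => orbit G y i j) q 0 1 x
            - orbitChristoffel (fun i j y => orbit G y i j) p 0 0 x
              * orbitChristoffel (fun i j y => orbit G y i j) q 1 1 x)
        - (3 / 4) * ∑ k, ∑ l, h G x k l
          * (partialDeriv (Fin.castAdd 2 1) (fun y => fUp G y 0 k) x
            - partialDeriv (Fin.castAdd 2 0) (fun y => fUp G y 1 k) x)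
          * (partialDeriv (Fin.castAdd 2 1) (fun y => fUp G y 0 l) x
            - partialDeriv (Fin.castAdd 2 0) (fun y => fUp G y 1 l) x) := by
  have hsm : ∀ i j, ContDiffOn ℝ ∞ (fun y => coordInner G y (horizontalVector G x i)
      (horizontalVector G x j)) U := fun i j => hG.contDiffOn_coordInner _ _
  have hD : ∀ m i j a : Fin 2, directionalDeriv (horizontalVector G x a)
      (christoffelForm G (horizontalVector G x m) (horizontalVector G x i)
        (horizontalVector G x j)) x
      = partialDeriv (Fin.castAdd 2 a) (orbitChristoffel
        (fun i j y => coordInner G y (horizontalVector G x i) (horizontalVector G x j)) m i j)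
        x := by
    intro m i j a
    rw [directionalDeriv_congr hG.isOpen (fun y hy => hG.christoffelForm_hhh hy x m i j) hx]
    exact directionalDeriv_horizontalVector (fun k => partialDeriv_natAdd_orbitChristoffel
      hG.isOpen hsm (fun i j y hy => hG.partialDeriv_natAdd_coordInner hy _ _ k) hx m i j) x a
  have hC : ∀ m i j : Fin 2, christoffelForm G (horizontalVector G x m) (horizontalVector G x i)
      (horizontalVector G x j) x = orbitChristoffel (fun i j y => orbit G y i j) m i j x := by
    intro m i j
    rw [hG.christoffelForm_hhh hx]
    simp only [orbitChristoffel, hG.partialDeriv_horizontal hx]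
  -- The vertical symbols carry an index lowered by h; contracting two of them with h⁻¹ leaves a
  -- plain h-product.
  have hv : ∀ s t : Fin 2 → ℝ, ∑ p, ∑ q, (h G x)⁻¹ p q * ((∑ l, h G x p l * s l)
      * ∑ l, h G x q l * t l) = ∑ k, ∑ l, h G x k l * s l * t k := by
    intro s t
    have h1 : ∀ p r, ∑ q, (h G x)⁻¹ p q * h G x q r = if p = r then 1 else 0 := fun p r => by
      rw [← Matrix.mul_apply, Matrix.nonsing_inv_mul _
        (isUnit_iff_ne_zero.2 (hG.det_h_ne_zero x hx)), Matrix.one_apply]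
    refine Finset.sum_congr rfl fun p _ => ?_
    have h2 : ∑ q, (h G x)⁻¹ p q * ∑ l, h G x q l * t l = t p := by
      simp only [Finset.mul_sum, ← mul_assoc]
      rw [Finset.sum_comm]
      simp only [← Finset.sum_mul, h1]
      simp
    rw [← Finset.sum_mul, ← h2, Finset.mul_sum]
    exact Finset.sum_congr rfl fun q _ => by ring
  have hs : h G x 1 0 = h G x 0 1 := hG.symm x hx _ _
  rw [hG.riemannForm_adapted hx]
  simp only [hD, hC, hG.christoffelForm_vhh hx, mul_sub ((h G x)⁻¹ _ _), Finset.sum_sub_distrib, hv]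
  rw [partialDeriv_orbitChristoffel hG.isOpen hsm hx,
    partialDeriv_orbitChristoffel hG.isOpen hsm hx,
    partialDeriv_orbitChristoffel hG.isOpen hG.contDiffOn_orbit hx,
    partialDeriv_orbitChristoffel hG.isOpen hG.contDiffOn_orbit hx]
  -- Put F_ij = ∂_i f_j, a vertical vector, with h as scalar product. The second derivatives of the
  -- error give ⟨F₀₀, F₁₁⟩ + ⟨F₁₀, F₀₁⟩ - |F₀₁|² - |F₁₀|², and the vertical symbols give ¼ |F₀₁ +
  -- F₁₀|² - ⟨F₀₀, F₁₁⟩. The sum is -¾ |F₁₀ - F₀₁|².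
  simp only [hG.partialDeriv_partialDeriv_horizontal hx, Fin.sum_univ_two, hs]
  ring

end IsAdaptedCoordMetric

/-! ### The orbit metric -/

theorem join_castAdd (t z : E2) (i : Fin 2) : join t z (Fin.castAdd 2 i) = t i :=
  Fin.append_left _ _ i

theorem join_natAdd (t z : E2) (k : Fin 2) : join t z (Fin.natAdd 2 k) = z k :=
  Fin.append_right _ _ k

theorem join_ext {x y : E4} (ht : ∀ i : Fin 2, x (Fin.castAdd 2 i) = y (Fin.castAdd 2 i))
    (hz : ∀ k : Fin 2, x (Fin.natAdd 2 k) = y (Fin.natAdd 2 k)) : x = y :=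
  PiLp.ext fun a => Fin.addCases ht hz a

theorem join_tPart_zPart (x : E4) : join (tPart x) (zPart x) = x :=
  join_ext (fun i => join_castAdd _ _ i) (fun k => join_natAdd _ _ k)

theorem hasFDerivAt_join (t z : E2) : ∃ L : E2 →L[ℝ] E4,
    HasFDerivAt (fun t => join t z) L t ∧
      ∀ i : Fin 2, L (EuclideanSpace.single i 1) = EuclideanSpace.single (Fin.castAdd 2 i) 1 := by
  let L : E2 →ₗ[ℝ] E4 :=
    { toFun := fun t => join t 0
      map_add' := fun s t => join_ext
        (fun i => by simp only [PiLp.add_apply, join_castAdd])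
        (fun k => by simp only [PiLp.add_apply, join_natAdd, PiLp.zero_apply, add_zero])
      map_smul' := fun c t => join_ext
        (fun i => by simp only [PiLp.smul_apply, join_castAdd, RingHom.id_apply])
        (fun k => by simp only [PiLp.smul_apply, join_natAdd, PiLp.zero_apply, smul_zero]) }
  have hLa : ∀ t, L t = join t 0 := fun _ => rfl
  have hL : (fun t => join t z) = fun t => L.toContinuousLinearMap t + join 0 z := by
    funext t
    refine join_ext (fun i => ?_) (fun k => ?_)
    · simp only [LinearMap.coe_toContinuousLinearMap', hLa, PiLp.add_apply, join_castAdd,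
        PiLp.zero_apply, add_zero]
    · simp only [LinearMap.coe_toContinuousLinearMap', hLa, PiLp.add_apply, join_natAdd,
        PiLp.zero_apply, zero_add]
  refine ⟨L.toContinuousLinearMap, ?_, fun i => join_ext (fun j => ?_) (fun k => ?_)⟩
  · rw [hL]
    exact L.toContinuousLinearMap.hasFDerivAt.add_const _
  · simp only [LinearMap.coe_toContinuousLinearMap', hLa, join_castAdd, PiLp.single_apply,
      Fin.castAdd_inj]
  · have : Fin.natAdd 2 k ≠ Fin.castAdd 2 i := by
      simp only [ne_eq, Fin.ext_iff, Fin.val_natAdd, Fin.val_castAdd]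
      omega
    simp only [LinearMap.coe_toContinuousLinearMap', hLa, join_natAdd, PiLp.single_apply, this,
      PiLp.zero_apply, if_false]

theorem contDiff_join (z : E2) : ContDiff ℝ ∞ (fun t => join t z) := by
  rw [contDiff_euclidean]
  intro a
  refine Fin.addCases (fun i => ?_) (fun k => ?_) a
  · simp only [join, Fin.append_left]
    fun_prop
  · simp only [join, Fin.append_right]
    exact contDiff_const

/-- Translates between the two-dimensional calculus that defines `Cric` and derivatives along t in
four dimensions. -/
theorem partialDeriv_comp_join {F : E4 → ℝ} {t z : E2} (hF : DifferentiableAt ℝ F (join t z))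
    (i : Fin 2) :
    partialDeriv i (fun t => F (join t z)) t = partialDeriv (Fin.castAdd 2 i) F (join t z) := by
  obtain ⟨L, hL, hi⟩ := hasFDerivAt_join t z
  have := (hF.hasFDerivAt.comp t hL).fderiv
  show fderiv ℝ (F ∘ fun t => join t z) t _ = _
  rw [this, ContinuousLinearMap.comp_apply, hi]
  rfl

namespace IsAdaptedCoordMetric

variable {U : Set E4} {G : E4 → Matrix (Fin (2 + 2)) (Fin (2 + 2)) ℝ} {x : E4}

theorem isCoordMetric_orbit (hG : IsAdaptedCoordMetric U G) (z : E2) :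
    IsCoordMetric ((fun t => join t z) ⁻¹' U) (fun t => orbit G (join t z)) where
  isOpen := hG.isOpen.preimage (contDiff_join z).continuous
  smooth i j := (hG.contDiffOn_orbit i j).comp (contDiff_join z).contDiffOn fun _ ht => ht
  symm _ ht i j := congrFun (congrFun (hG.orbit_symm ht) j) i
  det_ne_zero _ ht := hG.det_orbit_ne_zero ht

/-- On the slice of constant z the scalar curvature is 2 R₀₁₀₁ / det g̃. The expansion of R₀₁₀₁ is
put in the form of the orbit part of `riemannForm_horizontal`, so that the two can be matched term
by term. -/
theorem Cric_eq (hG : IsAdaptedCoordMetric U G) (hx : x ∈ U) :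
    Cric G x = 2 * (partialDeriv (Fin.castAdd 2 0)
          (orbitChristoffel (fun i j y => orbit G y i j) 0 1 1) x
        - partialDeriv (Fin.castAdd 2 1) (orbitChristoffel (fun i j y => orbit G y i j) 0 0 1) x
        + ∑ p, ∑ q, (orbit G x)⁻¹ p q *
          (orbitChristoffel (fun i j y => orbit G y i j) p 1 0 x
              * orbitChristoffel (fun i j y => orbit G y i j) q 0 1 x
            - orbitChristoffel (fun i j y => orbit G y i j) p 0 0 x
              * orbitChristoffel (fun i j y => orbit G y i j) q 1 1 x)) / (orbit G x).det := by
  have hO := hG.isCoordMetric_orbit (zPart x)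
  have hxj : join (tPart x) (zPart x) = x := join_tPart_zPart x
  have ht : tPart x ∈ (fun t => join t (zPart x)) ⁻¹' U := by
    show join (tPart x) (zPart x) ∈ U
    rwa [hxj]
  have hC : ∀ (m i j : Fin 2), ∀ t ∈ (fun t => join t (zPart x)) ⁻¹' U,
      christoffelLow (fun t => orbit G (join t (zPart x))) m i j t
      = orbitChristoffel (fun i j y => orbit G y i j) m i j (join t (zPart x)) := by
    intro m i j t ht
    have hd : ∀ i j, DifferentiableAt ℝ (fun y => orbit G y i j) (join t (zPart x)) := fun i j =>
      (hG.contDiffOn_orbit i j).differentiableAt_of_isOpen hG.isOpen ht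
    simp only [christoffelLow, orbitChristoffel]
    rw [partialDeriv_comp_join (hd m j), partialDeriv_comp_join (hd m i),
      partialDeriv_comp_join (hd i j)]
  have hD : ∀ m i j c : Fin 2, partialDeriv c
      (christoffelLow (fun t => orbit G (join t (zPart x))) m i j) (tPart x)
      = partialDeriv (Fin.castAdd 2 c) (orbitChristoffel (fun i j y => orbit G y i j) m i j)
        x := by
    intro m i j c
    rw [partialDeriv_congr hO.isOpen (hC m i j) ht, partialDeriv_comp_join, hxj]
    rw [hxj]
    exact (contDiffOn_orbitChristoffel hG.isOpen
      hG.contDiffOn_orbit m i j).differentiableAt_of_isOpen hG.isOpen hx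
  rw [Cric, hO.scalarCurvature_eq ht, hO.riemannLow_eq ht]
  simp only [hD, hC _ _ _ _ ht, hxj]

theorem coordSectional_horizontal (hG : IsAdaptedCoordMetric U G) (hx : x ∈ U) :
    coordSectional G x (horizontalVector G x 0) (horizontalVector G x 1)
      = (1 / 2) * Cric G x - Real.sign (orbit G x).det * (3 / 4) * ellC G x := by
  have hne := hG.det_orbit_ne_zero hx
  have hdet : (orbit G x).det = orbit G x 0 0 * orbit G x 1 1 - orbit G x 0 1 ^ 2 := by
    rw [Matrix.det_fin_two, show orbit G x 1 0 = orbit G x 0 1 from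
      congrFun (congrFun (hG.orbit_symm hx) 0) 1, sq]
  -- The two square roots in ℓ_𝒞 multiply to |det g̃|, and ε / |det g̃| = 1 / det g̃. This is why ε
  -- appears in the final formula.
  have hell : Real.sign (orbit G x).det * ellC G x
      = (∑ k, ∑ l, h G x k l
          * (partialDeriv (Fin.castAdd 2 1) (fun y => fUp G y 0 k) x
            - partialDeriv (Fin.castAdd 2 0) (fun y => fUp G y 1 k) x)
          * (partialDeriv (Fin.castAdd 2 1) (fun y => fUp G y 0 l) x
            - partialDeriv (Fin.castAdd 2 0) (fun y => fUp G y 1 l) x)) / (orbit G x).det := by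
    have hsq : √|(orbit G x).det| * √|(orbit G x).det| = |(orbit G x).det| :=
      Real.mul_self_sqrt (abs_nonneg _)
    have hsg : Real.sign (orbit G x).det * (|(orbit G x).det|)⁻¹ = ((orbit G x).det)⁻¹ := by
      rcases lt_or_gt_of_ne hne with hlt | hgt
      · rw [Real.sign_of_neg hlt, abs_of_neg hlt, inv_neg]
        ring
      · rw [Real.sign_of_pos hgt, abs_of_pos hgt, one_mul]
    rw [div_eq_mul_inv, ← hsg, ← hsq, mul_inv]
    simp only [ellC, curvVector, Fin.sum_univ_two, div_eq_mul_inv]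
    ring
  show riemannForm G x (horizontalVector G x 0) (horizontalVector G x 1) (horizontalVector G x 0)
    (horizontalVector G x 1) / _ = _
  rw [mul_right_comm, hell, hG.riemannForm_horizontal hx, hG.Cric_eq hx]
  simp only [hG.coordInner_horizontal_self hx, ← hdet]
  ring

end IsAdaptedCoordMetric

/-! ### Arbitrary bases of complementary orthogonal planes -/

namespace IsCoordMetric

variable {n : ℕ} {U : Set (EuclideanSpace ℝ (Fin n))}
  {G : EuclideanSpace ℝ (Fin n) → Matrix (Fin n) (Fin n) ℝ} {x : EuclideanSpace ℝ (Fin n)}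

theorem eq_zero_of_coordInner_eq_zero (hG : IsCoordMetric U G) (hx : x ∈ U)
    {s : Set (EuclideanSpace ℝ (Fin n))} (hs : ⊤ ≤ Submodule.span ℝ s)
    {v : EuclideanSpace ℝ (Fin n)} (hv : ∀ y ∈ s, coordInner G x v y = 0) : v = 0 := by
  have h0 : ∀ y, coordInner G x v y = 0 := by
    intro y
    induction hs (Submodule.mem_top : y ∈ ⊤) using Submodule.span_induction with
    | mem y hy => exact hv y hy
    | zero => simp [coordInner]
    | add y z _ _ hy hz => rw [coordInner_add_right, hy, hz, add_zero]
    | smul c y _ hy => rw [coordInner_smul_right, hy, mul_zero]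
  have : Matrix.vecMul v (G x) = 0 := by
    funext r
    rw [Pi.zero_apply, ← h0 (EuclideanSpace.single r 1), coordInner_single_right]
    rfl
  have := Matrix.eq_zero_of_vecMul_eq_zero (hG.det_ne_zero x hx) this
  exact PiLp.ext fun a => congrFun this a

/-- A kernel vector of the Gram matrix gives a combination of the `u i` orthogonal to every `u j`.
It is also orthogonal to every `w j`, hence to the whole space, so it is zero by nondegeneracy. -/
theorem gram_ne_zero (hG : IsCoordMetric U G) (hx : x ∈ U)
    {u w : Fin 2 → EuclideanSpace ℝ (Fin n)} (hu : LinearIndependent ℝ u)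
    (horth : ∀ i j, coordInner G x (u i) (w j) = 0)
    (hspan : ⊤ ≤ Submodule.span ℝ (Set.range u ∪ Set.range w)) :
    coordInner G x (u 0) (u 0) * coordInner G x (u 1) (u 1)
      - coordInner G x (u 0) (u 1) ^ 2 ≠ 0 := by
  intro h0
  have hdet : (Matrix.of fun i j => coordInner G x (u i) (u j)).det = 0 := by
    rw [Matrix.det_fin_two, ← h0]
    simp only [Matrix.of_apply, hG.coordInner_symm hx (u 1) (u 0)]
    ring
  obtain ⟨c, hc, hc0⟩ := Matrix.exists_vecMul_eq_zero_iff.2 hdet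
  refine hc ?_
  have hv : ∑ i, c i • u i = 0 := by
    refine hG.eq_zero_of_coordInner_eq_zero hx hspan ?_
    rintro _ (⟨j, rfl⟩ | ⟨j, rfl⟩)
    · have := congrFun hc0 j
      simpa [Matrix.vecMul, dotProduct, Fin.sum_univ_two, coordInner_add_left,
        coordInner_smul_left] using this
    · simp [Fin.sum_univ_two, coordInner_add_left, coordInner_smul_left, horth]
  exact funext (Fintype.linearIndependent_iff.1 hu c hv)

end IsCoordMetric

theorem top_le_span_of_disjoint {V : Type*} [AddCommGroup V] [Module ℝ V] (L : V ≃ₗ[ℝ] E4)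
    {u w : Fin 2 → V} (hu : LinearIndependent ℝ u) (hw : LinearIndependent ℝ w) {A B : Submodule ℝ V}
    (hA : ∀ i, u i ∈ A) (hB : ∀ i, w i ∈ B) (hAB : Disjoint A B) :
    ⊤ ≤ Submodule.span ℝ (Set.range (fun i => L (u i)) ∪ Set.range fun i => L (w i)) := by
  have hdis : Disjoint (Submodule.span ℝ (Set.range u)) (Submodule.span ℝ (Set.range w)) :=
    hAB.mono (Submodule.span_le.2 (Set.range_subset_iff.2 hA))
      (Submodule.span_le.2 (Set.range_subset_iff.2 hB))
  have hli : LinearIndependent ℝ (L ∘ Sum.elim u w) :=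
    (hu.sum_type hw hdis).map' L.toLinearMap L.ker
  have := hli.span_eq_top_of_card_eq_finrank (by simp)
  rw [Sum.comp_elim, Set.Sum.elim_range] at this
  exact this.ge

theorem IsCoordMetric.coordSectional_eq_of_disjoint {U : Set E4}
    {G : E4 → Matrix (Fin (2 + 2)) (Fin (2 + 2)) ℝ} {x : E4} (hG : IsCoordMetric U G) (hx : x ∈ U)
    {Λ : ℝ} (hΛ : ∀ j k, ricci G j k x = Λ * G x j k) {V : Type*} [AddCommGroup V] [Module ℝ V]
    (L : V ≃ₗ[ℝ] E4) {u w : Fin 2 → V} (hu : LinearIndependent ℝ u) (hw : LinearIndependent ℝ w)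
    {A B : Submodule ℝ V} (hA : ∀ i, u i ∈ A) (hB : ∀ i, w i ∈ B) (hAB : Disjoint A B)
    (horth : ∀ i j, coordInner G x (L (u i)) (L (w j)) = 0) :
    coordSectional G x (L (u 0)) (L (u 1)) = coordSectional G x (L (w 0)) (L (w 1)) := by
  have horth' : ∀ i j, coordInner G x (L (w i)) (L (u j)) = 0 := fun i j => by
    rw [hG.coordInner_symm hx, horth]
  have hLu : LinearIndependent ℝ fun i => L (u i) := hu.map' L.toLinearMap L.ker
  have hLw : LinearIndependent ℝ fun i => L (w i) := hw.map' L.toLinearMap L.ker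
  have hspan := top_le_span_of_disjoint L hu hw hA hB hAB
  have h1 := hG.gram_ne_zero hx hLu horth hspan
  have hspan' : ⊤ ≤ Submodule.span ℝ
      (Set.range (fun i => L (w i)) ∪ Set.range fun i => L (u i)) := by
    rw [Set.union_comm]
    exact hspan
  have h2 := hG.gram_ne_zero hx hLw horth' hspan'
  have h3 := hG.coordSectional_eq_of_einstein hx hΛ horth h1 h2 hspan
  exact h3

/-! ### Passing from the manifold to coordinates -/

section Charts

variable {M : Type*} [TopologicalSpace M] [ChartedSpace E4 M]
  {φ : OpenPartialHomeomorph M E4} {p : M}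

/-- The derivative of a smooth chart is invertible on its source, so `inverse` in `coordVector` is a
true inverse there and not its default value 0. -/
theorem exists_coordComponents_equiv (hφ : φ ∈ IsManifold.maximalAtlas 𝓘(ℝ, E4) ∞ M)
    (hp : p ∈ φ.source) :
    ∃ L : TangentSpace 𝓘(ℝ, E4) p ≃ₗ[ℝ] E4, (∀ v, coordComponents φ p v = L v) ∧
      ∀ a, coordVector φ p a = L.symm (EuclideanSpace.single a 1) := by
  have h1 : φ ∈ IsManifold.maximalAtlas 𝓘(ℝ, E4) 1 M :=
    IsManifold.maximalAtlas_subset_of_le (by simp) hφ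
  have hd : φ.MDifferentiable 𝓘(ℝ, E4) 𝓘(ℝ, E4) :=
    ⟨fun q hq => (mdifferentiableAt_of_mem_maximalAtlas h1 hq).mdifferentiableWithinAt,
      fun q hq => (mdifferentiableAt_symm_of_mem_maximalAtlas h1 hq).mdifferentiableWithinAt⟩
  refine ⟨(hd.mfderiv hp).toLinearEquiv, fun v => rfl, fun a => ?_⟩
  have : mfderiv 𝓘(ℝ, E4) 𝓘(ℝ, E4) φ p
      = (hd.mfderiv hp : TangentSpace 𝓘(ℝ, E4) p →L[ℝ] TangentSpace 𝓘(ℝ, E4) (φ p)) := rfl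
  rw [coordVector, this, ContinuousLinearMap.inverse_equiv]
  rfl

theorem coordComponents_coordVector (hφ : φ ∈ IsManifold.maximalAtlas 𝓘(ℝ, E4) ∞ M)
    (hp : p ∈ φ.source) (a : Fin (2 + 2)) :
    coordComponents φ p (coordVector φ p a) = EuclideanSpace.single a 1 := by
  obtain ⟨L, h1, h2⟩ := exists_coordComponents_equiv hφ hp
  rw [h1, h2, LinearEquiv.apply_symm_apply]

theorem PseudoRiemannianMetric.val_eq_coordInner (g : PseudoRiemannianMetric M)
    (hφ : φ ∈ IsManifold.maximalAtlas 𝓘(ℝ, E4) ∞ M) (hp : p ∈ φ.source)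
    (u v : TangentSpace 𝓘(ℝ, E4) p) :
    g.val p u v
      = coordInner (g.components φ) (φ p) (coordComponents φ p u) (coordComponents φ p v) := by
  obtain ⟨L, h1, h2⟩ := exists_coordComponents_equiv hφ hp
  have hc : ∀ a b, g.components φ (φ p) a b
      = g.val p (L.symm (EuclideanSpace.single a 1)) (L.symm (EuclideanSpace.single b 1)) := by
    intro a b
    rw [← h2, ← h2]
    simp only [components, Matrix.of_apply]
    rw [φ.left_inv hp]
  have hs : ∀ v : TangentSpace 𝓘(ℝ, E4) p,
      v = ∑ a, L v a • L.symm (EuclideanSpace.single a 1) := by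
    intro v
    apply L.injective
    rw [map_sum]
    simp only [map_smul, LinearEquiv.apply_symm_apply]
    have := (EuclideanSpace.basisFun (Fin (2 + 2)) ℝ).sum_repr (L v)
    simp only [EuclideanSpace.basisFun_repr, EuclideanSpace.basisFun_apply] at this
    exact this.symm
  rw [h1, h1]
  conv_lhs => rw [hs u, hs v]
  simp only [coordInner, hc, map_sum, LinearMap.sum_apply, map_smul, LinearMap.smul_apply,
    smul_eq_mul, Finset.mul_sum]
  rw [Finset.sum_comm]
  exact Finset.sum_congr rfl fun _ _ => Finset.sum_congr rfl fun _ _ => by ring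

theorem PseudoRiemannianMetric.isCoordMetric (g : PseudoRiemannianMetric M)
    (hφ : φ ∈ IsManifold.maximalAtlas 𝓘(ℝ, E4) ∞ M) :
    IsCoordMetric φ.target (g.components φ) where
  isOpen := φ.open_target
  smooth := g.smooth φ hφ
  symm _ _ _ _ := g.symm _ _ _
  det_ne_zero x hx h0 := by
    obtain ⟨c, hc, hc0⟩ := Matrix.exists_vecMul_eq_zero_iff.2 h0
    have hp : φ.symm x ∈ φ.source := φ.map_target hx
    obtain ⟨L, h1, h2⟩ := exists_coordComponents_equiv hφ hp
    -- A kernel vector of the component matrix is the coordinate expression of a tangent vector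
    -- orthogonal to everything.
    have hz : L.symm (WithLp.toLp 2 c) = 0 := by
      refine g.nondegenerate _ _ fun v => ?_
      rw [g.val_eq_coordInner hφ hp, h1, LinearEquiv.apply_symm_apply, φ.right_inv hx]
      rw [coordInner, Finset.sum_comm]
      refine Finset.sum_eq_zero fun j _ => ?_
      rw [← Finset.sum_mul]
      have : ∑ i, g.components φ x i j * c i = 0 := by
        have := congrFun hc0 j
        simpa only [Matrix.vecMul, dotProduct, mul_comm, Pi.zero_apply] using this
      rw [this, zero_mul]
    rw [LinearEquiv.map_eq_zero_iff] at hz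
    exact hc (funext fun a => congrArg (fun v : E4 => v a) hz)

theorem coordComponents_horizontalFrame (g : PseudoRiemannianMetric M)
    (hφ : φ ∈ IsManifold.maximalAtlas 𝓘(ℝ, E4) ∞ M) (hp : p ∈ φ.source) (i : Fin 2) :
    coordComponents φ p (horizontalFrame g φ p i)
      = horizontalVector (g.components φ) (φ p) i := by
  obtain ⟨L, h1, h2⟩ := exists_coordComponents_equiv hφ hp
  rw [h1, horizontalFrame, horizontalVector, map_sub, map_sum]
  simp only [map_smul, h2, LinearEquiv.apply_symm_apply]

theorem PseudoRiemannianMetric.IsLambdaVacuum.ricci_eq {g : PseudoRiemannianMetric M} {Λ : ℝ}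
    (hΛ : g.IsLambdaVacuum Λ) (hφ : φ ∈ IsManifold.maximalAtlas 𝓘(ℝ, E4) ∞ M) {x : E4}
    (hx : x ∈ φ.target) (a b : Fin (2 + 2)) :
    ricci (g.components φ) a b x = Λ * g.components φ x a b :=
  sub_eq_zero.1 (hΛ φ hφ x hx a b)

variable [IsManifold 𝓘(ℝ, E4) ∞ M]

/-- In adapted coordinates the components of ξ_k are constant, so the Killing equation reduces to
∂g_ab/∂zᵏ = 0; and h is the Gram matrix of ξ₁, ξ₂. -/
theorem IsG2Metric.isAdaptedCoordMetric {g : PseudoRiemannianMetric M}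
    {ξ : Fin 2 → ∀ p : M, TangentSpace 𝓘(ℝ, E4) p} (hg : IsG2Metric g ξ) (hφ : IsAdapted ξ φ) :
    IsAdaptedCoordMetric φ.target (g.components φ) where
  toIsCoordMetric := g.isCoordMetric hφ.1
  det_h_ne_zero x hx := by
    have := hg.nonnull (φ.symm x)
    simp only [hφ.2 _ (φ.map_target hx)] at this
    exact this
  invariant k a b x hx := by
    have hc : ∀ y ∈ φ.target, coordComponents φ (φ.symm y) (ξ k (φ.symm y))
        = EuclideanSpace.single (Fin.natAdd 2 k) 1 := fun y hy => by
      rw [hφ.2 _ (φ.map_target hy), coordComponents_coordVector hφ.1 (φ.map_target hy)]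
    have hd : ∀ a c, partialDeriv a
        (fun y => coordComponents φ (φ.symm y) (ξ k (φ.symm y)) c) x = 0 := by
      intro a c
      rw [partialDeriv_congr φ.open_target
        (fun y hy => congrArg (fun v : E4 => v c) (hc y hy)) hx]
      simp [partialDeriv]
    have := hg.killing k φ hφ.1 x hx a b
    simp only [hd, hc x hx, zero_mul, add_zero, PiLp.single_apply, ite_mul, one_mul,
      Finset.sum_ite_eq', Finset.mem_univ, if_true] at this
    exact this

/-- The coefficients of a vector in the intersection lie in the kernel of the Gram matrix of ξ₁, ξ₂,
which is invertible. -/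
theorem IsG2Metric.disjoint_killing_orthogonal {g : PseudoRiemannianMetric M}
    {ξ : Fin 2 → ∀ p : M, TangentSpace 𝓘(ℝ, E4) p} (hg : IsG2Metric g ξ) (p : M) :
    Disjoint (killingDistribution ξ p) (orthogonalDistribution g ξ p) := by
  rw [Submodule.disjoint_def]
  intro v hv hv'
  obtain ⟨c, rfl⟩ := (Submodule.mem_span_range_iff_exists_fun ℝ).1 hv
  have h0 : Matrix.mulVec (Matrix.of fun k l => g.val p (ξ k p) (ξ l p)) c = 0 := by
    funext l
    have := LinearMap.BilinForm.mem_orthogonal_iff.1 hv' (ξ l p) (Submodule.subset_span ⟨l, rfl⟩)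
    rw [map_sum] at this
    simpa [Matrix.mulVec, dotProduct, mul_comm] using this
  have := Matrix.eq_zero_of_mulVec_eq_zero (hg.nonnull p) h0
  simp [this]

theorem IsG2Metric.sectional_eq {g : PseudoRiemannianMetric M}
    {ξ : Fin 2 → ∀ p : M, TangentSpace 𝓘(ℝ, E4) p} (hg : IsG2Metric g ξ) {Λ : ℝ}
    (hΛ : g.IsLambdaVacuum Λ) (hφ : φ ∈ IsManifold.maximalAtlas 𝓘(ℝ, E4) ∞ M)
    (hp : p ∈ φ.source) {u w : Fin 2 → TangentSpace 𝓘(ℝ, E4) p} (hu : LinearIndependent ℝ u)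
    (hu' : ∀ i, u i ∈ killingDistribution ξ p) (hw : LinearIndependent ℝ w)
    (hw' : ∀ i, w i ∈ orthogonalDistribution g ξ p) :
    g.sectional φ p (u 0) (u 1) = g.sectional φ p (w 0) (w 1) := by
  obtain ⟨L, h1, -⟩ := exists_coordComponents_equiv hφ hp
  have hx := φ.map_source hp
  have horth : ∀ i j, coordInner (g.components φ) (φ p) (L (u i)) (L (w j)) = 0 := by
    intro i j
    rw [← h1, ← h1, ← g.val_eq_coordInner hφ hp]
    exact LinearMap.BilinForm.mem_orthogonal_iff.1 (hw' j) _ (hu' i)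
  rw [PseudoRiemannianMetric.sectional, PseudoRiemannianMetric.sectional, h1, h1, h1, h1]
  exact (g.isCoordMetric hφ).coordSectional_eq_of_disjoint hx (hΛ.ricci_eq hφ hx) L hu hw hu' hw'
    (hg.disjoint_killing_orthogonal p) horth

end Charts

theorem IsAdaptedCoordMetric.coordSectional_eq {U : Set E4}
    {G : E4 → Matrix (Fin (2 + 2)) (Fin (2 + 2)) ℝ} {x : E4} (hG : IsAdaptedCoordMetric U G)
    (hx : x ∈ U) {Λ : ℝ} (hΛ : ∀ j k, ricci G j k x = Λ * G x j k) :
    coordSectional G x (horizontalVector G x 0) (horizontalVector G x 1)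
      = coordSectional G x (verticalVector 0) (verticalVector 1) := by
  refine hG.coordSectional_eq_of_einstein hx hΛ (hG.coordInner_horizontal_vertical_self hx) ?_ ?_
    (top_le_span G x)
  · have := hG.det_orbit_ne_zero hx
    rw [Matrix.det_fin_two, show orbit G x 1 0 = orbit G x 0 1 from
      congrFun (congrFun (hG.orbit_symm hx) 0) 1, ← sq] at this
    simpa only [hG.coordInner_horizontal_self hx] using this
  · have := hG.det_h_ne_zero x hx
    rw [Matrix.det_fin_two, show h G x 1 0 = h G x 0 1 from hG.symm x hx _ _, ← sq] at this
    simpa only [coordInner_vertical_vertical] using this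

end

theorem mainTheorem12 {M : Type*} [TopologicalSpace M] [ChartedSpace E4 M]
    [IsManifold 𝓘(ℝ, E4) ∞ M] (g : PseudoRiemannianMetric M)
    (ξ : Fin 2 → ∀ p : M, TangentSpace 𝓘(ℝ, E4) p) (hg : IsG2Metric g ξ)
    (Λ : ℝ) (hΛ : g.IsLambdaVacuum Λ) :
    (∀ φ ∈ IsManifold.maximalAtlas 𝓘(ℝ, E4) ∞ M, ∀ p ∈ φ.source,
      ∀ u w : Fin 2 → TangentSpace 𝓘(ℝ, E4) p,
        LinearIndependent ℝ u → (∀ i, u i ∈ killingDistribution ξ p) →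
        LinearIndependent ℝ w → (∀ i, w i ∈ orthogonalDistribution g ξ p) →
        g.sectional φ p (u 0) (u 1) = g.sectional φ p (w 0) (w 1)) ∧
    (∀ φ, IsAdapted ξ φ → ∀ p ∈ φ.source,
      g.sectional φ p (coordVector φ p (Fin.natAdd 2 0)) (coordVector φ p (Fin.natAdd 2 1))
          = -(1 / 4) * Adapted.Cchi (g.components φ) (φ p) ∧
      g.sectional φ p (horizontalFrame g φ p 0) (horizontalFrame g φ p 1)
          = (1 / 2) * Adapted.Cric (g.components φ) (φ p)
            - Real.sign (Adapted.orbit (g.components φ) (φ p)).det * (3 / 4)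
              * Adapted.ellC (g.components φ) (φ p) ∧
      Adapted.Cric (g.components φ) (φ p) + (1 / 2) * Adapted.Cchi (g.components φ) (φ p)
          - Real.sign (Adapted.orbit (g.components φ) (φ p)).det * (3 / 2)
            * Adapted.ellC (g.components φ) (φ p) = 0) := by
  refine ⟨fun φ hφ p hp u w hu hu' hw hw' => hg.sectional_eq hΛ hφ hp hu hu' hw hw',
    fun φ hφ p hp => ?_⟩
  have hG := hg.isAdaptedCoordMetric hφ
  have hx := φ.map_source hp
  have hV := hG.coordSectional_vertical hx
  have hH := hG.coordSectional_horizontal hx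
  have hE := hG.coordSectional_eq hx (hΛ.ricci_eq hφ.1 hx)
  -- The third identity is twice the equality `hE` of the two curvatures after inserting `hV` and
  -- `hH`.
  refine ⟨?_, ?_, by linarith⟩
  · rw [PseudoRiemannianMetric.sectional, coordComponents_coordVector hφ.1 hp,
      coordComponents_coordVector hφ.1 hp]
    exact hV
  · rw [PseudoRiemannianMetric.sectional, coordComponents_horizontalFrame g hφ.1 hp,
      coordComponents_horizontalFrame g hφ.1 hp]
    exact hH
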